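/- The classical scalar weights are the following, where $\partial = d/dx$ and $\partial^i f$ denotes the operator $p \mapsto p \cdot \partial^i f = p^{(i)} f$: * shifted Hermite, $b\in\mathbb R$: $w(x)=e^{-x^2+2bx}$ on $(-\infty,\infty)$, with $\delta=\partial^2-2\,\partial(x-b)$; * Laguerre, $\alpha>-1$: $w(x)=e^{-x}x^{\alpha}$ on $(0,\infty)$, with $\delta=\partial^2x+\partial(\alpha+1-x)$; * Jacobi, $\alpha,\beta>-1$: $w(x)=(1-x)^\alpha(1+x)^\beta$ on $(-1,1)$, with $\delta=\partial^2(1-x^2)+\partial(\beta-\alpha-x(\alpha+\beta+2))$. For a weight matrix $W$ of size $N$ on an interval, with monic orthogonal polynomials $(P_n)_{n\ge0}$ with respect to $\langle P,Q\rangle_W=\int P(x)W(x)Q(x)^*\,dx$, let $\mathcal D(W)$ be the algebra of all differential operators $D=\sum_i\partial^iF_i$, $F_i\in\operatorname{Mat}_N(\mathbb C[x])$, acting on the right by $P\cdot D=\sum_i P^{(i)}F_i$, such that for every $n\ge0$ there is $\Lambda_n\in\operatorname{Mat}_N(\mathbb C)$ with $P_n\cdot D=\Lambda_nP_n$; let $\mathcal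 Z(W)$ be its center. A weight $\widetilde W$ on the same interval, with monic orthogonal polynomials $\widetilde P_n$, is a Darboux transformation of $W$ if there are differential operators $\mathcal V,\mathcal N$ with coefficients in $\operatorname{Mat}_N(\mathbb C[x])$ that preserve the degree of every matrix polynomial, such that $\mathcal V\mathcal N\in\mathcal D(W)$ and, for all $n\ge 0$, $P_n\cdot\mathcal V=A_n\widetilde P_n$ for some $A_n\in\operatorname{Mat}_N(\mathbb C)$; this is an equivalence relation. Theorem. Let $N\ge1$, let $w_1,\dots,w_N$ be classical scalar weights in the same Darboux equivalence class (each $w_j$ is a Darboux transformation of each $w_i$), let $\delta_j$ be the second-order operator associated with $w_j$ above, and put $\Delta=\operatorname{diag}(\delta_1,\dots,\delta_N)$. Then the center of $\mathcal D(w_1\oplus\cdots\oplus w_N)$ is the polynomial algebra $\mathbb C[\Delta]$ generated by $\Delta$ (and $\Delta$ is transcendental over $\mathbb C$). Explicitly, $$\mathcal Z(w_1\oplus\cdots\oplus w_N)=\{p(\Delta):p\in\mathbb C[x]\}=\{\operatorname{diag}(p(\delta_1),\dots,p(\delta_N)):p\in\mathbb C[x]\}.$$ -/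

import Mathlib

open Polynomial MeasureTheory
open scoped ComplexOrder ContDiff

noncomputable section

/-! ### Scalar differential operators with polynomial coefficients, acting on the right -/

/-- The algebra `Ω[x]` of the operators `∑ j, ∂ ^ j f_j` with `f_j ∈ ℂ[x]`, which act on the right
by `p · D = ∑ j, p^(j) f_j`. An operator is identified with its action on `ℂ[x]`; since operators
act on the right, the product `D₁ D₂` means "first `D₁`, then `D₂`", whence the opposite algebra. -/
def WeylAlgebra : Subalgebra ℂ (Module.End ℂ ℂ[X])ᵐᵒᵖ where
  carrier := {D | ∃ (m : ℕ) (f : ℕ → ℂ[X]), ∀ p : ℂ[X],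
    D.unop p = ∑ j ∈ Finset.range m, derivative^[j] p * f j}
  algebraMap_mem' := by
    intro r
    refine ⟨1, fun _ => C r, fun p => ?_⟩
    simp [MulOpposite.algebraMap_apply, Polynomial.smul_eq_C_mul, mul_comm]
  add_mem' := by
    rintro a b ⟨m, f, hf⟩ ⟨k, g, hg⟩
    have extend : ∀ (n M : ℕ) (h : ℕ → ℂ[X]) (p : ℂ[X]), n ≤ M →
        ∑ j ∈ Finset.range n, derivative^[j] p * h j =
          ∑ j ∈ Finset.range M, derivative^[j] p * (if j < n then h j else 0) := by
      intro n M h p hnM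
      rw [← Finset.sum_subset (Finset.range_mono hnM)]
      · exact Finset.sum_congr rfl fun j hj => by simp [Finset.mem_range.1 hj]
      · intro j _ hj
        simp [Finset.mem_range] at hj
        simp [not_lt.2 hj]
    refine ⟨max m k, fun j => (if j < m then f j else 0) + (if j < k then g j else 0),
      fun p => ?_⟩
    simp only [MulOpposite.unop_add, LinearMap.add_apply, hf, hg, mul_add, Finset.sum_add_distrib]
    rw [extend m (max m k) f p (le_max_left _ _), extend k (max m k) g p (le_max_right _ _)]
  mul_mem' := by
    rintro a b ⟨m, f, hf⟩ ⟨k, g, hg⟩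
    have key : ∀ i : ℕ, ∃ (M : ℕ) (c : ℕ → ℂ[X]), ∀ p : ℂ[X],
        derivative^[i] (a.unop p) = ∑ j ∈ Finset.range M, derivative^[j] p * c j := by
      intro i
      induction i with
      | zero => exact ⟨m, f, hf⟩
      | succ i ih =>
        obtain ⟨M, c, hc⟩ := ih
        refine ⟨M + 1, fun j => (if j < M then derivative (c j) else 0) +
          (if j = 0 then 0 else c (j - 1)), fun p => ?_⟩
        rw [Function.iterate_succ_apply', hc]
        simp only [derivative_sum, derivative_mul, mul_add, Finset.sum_add_distrib]
        rw [Finset.sum_range_succ, Finset.sum_range_succ']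
        simp only [← Function.iterate_succ_apply' derivative]
        rw [add_comm]
        simp
        exact Finset.sum_congr rfl fun j hj => by simp [Finset.mem_range.1 hj]
    have tot : ∀ n : ℕ, ∃ (M : ℕ) (c : ℕ → ℂ[X]), ∀ p : ℂ[X],
        ∑ i ∈ Finset.range n, derivative^[i] (a.unop p) * g i =
          ∑ j ∈ Finset.range M, derivative^[j] p * c j := by
      intro n
      induction n with
      | zero => exact ⟨0, 0, by simp⟩
      | succ n ih =>
        obtain ⟨M₁, c₁, h₁⟩ := ih
        obtain ⟨M₂, c₂, h₂⟩ := key n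
        refine ⟨max M₁ M₂, fun j => (if j < M₁ then c₁ j else 0) +
          (if j < M₂ then c₂ j * g n else 0), fun p => ?_⟩
        rw [Finset.sum_range_succ, h₁, h₂]
        simp only [mul_add, Finset.sum_add_distrib, mul_ite, mul_zero, ← Finset.sum_filter,
          Finset.sum_mul]
        congr 1
        · refine Finset.sum_congr ?_ fun _ _ => rfl
          ext j; simp; omega
        · refine Finset.sum_congr ?_ fun _ _ => by ring
          ext j; simp; omega
    obtain ⟨M, c, hc⟩ := tot k
    refine ⟨M, c, fun p => ?_⟩
    rw [MulOpposite.unop_mul, Module.End.mul_apply, hg, hc]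

namespace WeylAlgebra

/-- The operator `∂ = d/dx`. -/
def dx : WeylAlgebra :=
  ⟨MulOpposite.op derivative, 2, fun j => if j = 1 then 1 else 0, fun p => by simp⟩

/-- The operator `p ↦ p f` of order zero. -/
def mulBy (f : ℂ[X]) : WeylAlgebra :=
  ⟨MulOpposite.op (LinearMap.mulRight ℂ f), 1, fun _ => f, fun p => by simp⟩

/-- The right action `p · D` of a scalar differential operator on a polynomial. -/
def act (p : ℂ[X]) (D : WeylAlgebra) : ℂ[X] := (D : (Module.End ℂ ℂ[X])ᵐᵒᵖ).unop p

end WeylAlgebra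

/-! ### Matrix differential operators -/

section MatrixOperators

variable {ι : Type*} [Fintype ι]

/-- The right action `(P · D)_{ij} = ∑ k, P_{ik} · D_{kj}` of a matrix differential operator
`D ∈ Mat_N(Ω[x])` on a matrix polynomial. -/
def matAct (P : Matrix ι ι ℂ[X]) (D : Matrix ι ι WeylAlgebra) : Matrix ι ι ℂ[X] :=
  Matrix.of fun i j => ∑ k, WeylAlgebra.act (P i k) (D k j)

/-- The degree of a matrix polynomial (`⊥` for the zero polynomial). -/
def matDegree (P : Matrix ι ι ℂ[X]) : WithBot ℕ :=
  Finset.univ.sup fun ij : ι × ι => (P ij.1 ij.2).degree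

/-- Operators that preserve the degree of every matrix polynomial. -/
def IsDegreePreserving (V : Matrix ι ι WeylAlgebra) : Prop :=
  ∀ P : Matrix ι ι ℂ[X], matDegree (matAct P V) = matDegree P

theorem matAct_add (P : Matrix ι ι ℂ[X]) (D E : Matrix ι ι WeylAlgebra) :
    matAct P (D + E) = matAct P D + matAct P E := by
  ext1 i j
  simp [matAct, WeylAlgebra.act, Finset.sum_add_distrib]

theorem matAct_mul (P : Matrix ι ι ℂ[X]) (D E : Matrix ι ι WeylAlgebra) :
    matAct P (D * E) = matAct (matAct P D) E := by
  ext1 i j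
  simp only [matAct, WeylAlgebra.act, Matrix.of_apply, Matrix.mul_apply,
    AddSubmonoidClass.coe_finsetSum, Finset.unop_sum, LinearMap.sum_apply, map_sum,
    MulMemClass.coe_mul, MulOpposite.unop_mul, Module.End.mul_apply]
  exact Finset.sum_comm

theorem matAct_algebraMap [DecidableEq ι] (P : Matrix ι ι ℂ[X]) (r : ℂ) :
    matAct P (algebraMap ℂ (Matrix ι ι WeylAlgebra) r) =
      (algebraMap ℂ (Matrix ι ι ℂ) r).map C * P := by
  ext1 i j
  simp only [matAct, WeylAlgebra.act, Matrix.of_apply, Matrix.algebraMap_matrix_apply,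
    Matrix.mul_apply, Matrix.map_apply]
  rw [Finset.sum_eq_single j, Finset.sum_eq_single i]
  · simp [MulOpposite.algebraMap_apply, Polynomial.smul_eq_C_mul]
  · intro k _ hk; simp [hk.symm]
  · simp
  · intro k _ hk; simp [hk]
  · simp

theorem matAct_const_mul (L : Matrix ι ι ℂ) (P : Matrix ι ι ℂ[X]) (D : Matrix ι ι WeylAlgebra) :
    matAct (L.map C * P) D = L.map C * matAct P D := by
  ext1 i j
  simp only [matAct, WeylAlgebra.act, Matrix.of_apply, Matrix.mul_apply, Matrix.map_apply,
    map_sum, ← Polynomial.smul_eq_C_mul, map_smul, Finset.smul_sum]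
  exact Finset.sum_comm

end MatrixOperators

/-! ### Weight matrices, orthogonal polynomials, the algebra `𝒟(W)` and its center -/

/-- A weight matrix on the open interval `I`: a smooth matrix function on `I`, positive definite
almost everywhere, with finite moments of all orders. (Values outside `I` play no role.) -/
structure WeightMatrix (I : Set ℝ) (ι : Type*) [Fintype ι] where
  toFun : ℝ → Matrix ι ι ℂ
  isOpen : IsOpen I
  ordConnected : I.OrdConnected
  nonempty : I.Nonempty
  smooth : ∀ i j, ContDiffOn ℝ ∞ (fun x => toFun x i j) I
  posDef : ∀ᵐ x ∂(volume.restrict I), (toFun x).PosDef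
  moments : ∀ (n : ℕ) (i j : ι), IntegrableOn (fun x : ℝ => (x : ℂ) ^ n * toFun x i j) I

namespace WeightMatrix

variable {I : Set ℝ} {ι : Type*} [Fintype ι] [DecidableEq ι]

/-- The matrix-valued sesquilinear form `⟨P, Q⟩_W = ∫_I P(x) W(x) Q(x)^* dx`. -/
def form (W : WeightMatrix I ι) (P Q : Matrix ι ι ℂ[X]) : Matrix ι ι ℂ :=
  Matrix.of fun i j => ∫ x in I,
    (P.map (eval (x : ℂ)) * W.toFun x * (Q.map (eval (x : ℂ))).conjTranspose) i j

/-- `P` is the sequence of monic orthogonal polynomials of `W`. -/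
structure IsMonicOrthogonal (W : WeightMatrix I ι) (P : ℕ → Matrix ι ι ℂ[X]) : Prop where
  monic : ∀ n, (P n).map (fun p => p.coeff n) = 1
  degree_le : ∀ n m, n < m → (P n).map (fun p => p.coeff m) = 0
  orthogonal : ∀ n m, n ≠ m → W.form (P n) (P m) = 0

/-- The algebra `𝒟(W)` of the operators having the orthogonal polynomials as eigenfunctions. -/
def diffAlgebra (W : WeightMatrix I ι) : Subalgebra ℂ (Matrix ι ι WeylAlgebra) where
  carrier := {D | ∀ P : ℕ → Matrix ι ι ℂ[X], W.IsMonicOrthogonal P →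
    ∀ n, ∃ L : Matrix ι ι ℂ, matAct (P n) D = L.map C * P n}
  algebraMap_mem' := fun r P _ n => ⟨_, matAct_algebraMap (P n) r⟩
  add_mem' := by
    intro D E hD hE P hP n
    obtain ⟨L, hL⟩ := hD P hP n
    obtain ⟨M, hM⟩ := hE P hP n
    exact ⟨L + M, by rw [matAct_add, hL, hM, Matrix.map_add _ (map_add C), add_mul]⟩
  mul_mem' := by
    intro D E hD hE P hP n
    obtain ⟨L, hL⟩ := hD P hP n
    obtain ⟨M, hM⟩ := hE P hP n
    exact ⟨L * M, by rw [matAct_mul, hL, matAct_const_mul, hM, Matrix.map_mul, mul_assoc]⟩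

/-- The center `𝒵(W)` of the algebra `𝒟(W)`, as an algebra of differential operators. -/
def center (W : WeightMatrix I ι) : Subalgebra ℂ (Matrix ι ι WeylAlgebra) :=
  (Subalgebra.center ℂ W.diffAlgebra).map W.diffAlgebra.val

/-- `W'` is a Darboux transformation of `W` (weights on the same interval): some operator of
`𝒟(W)` factors as `V N` with degree-preserving `V`, `N`, and `V` maps the monic orthogonal
polynomials of `W` to left multiples of those of `W'`. -/
def IsDarbouxTransformation (W W' : WeightMatrix I ι) : Prop :=
  ∃ V N : Matrix ι ι WeylAlgebra, IsDegreePreserving V ∧ IsDegreePreserving N ∧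
    V * N ∈ W.diffAlgebra ∧
    ∀ P P' : ℕ → Matrix ι ι ℂ[X], W.IsMonicOrthogonal P → W'.IsMonicOrthogonal P' →
      ∀ n, ∃ A : Matrix ι ι ℂ, matAct (P n) V = A.map C * P' n

end WeightMatrix

/-! ### Classical scalar weights -/

/-- The three types of classical scalar weights. -/
inductive ClassicalType
  | hermite
  | laguerre
  | jacobi

/-- The interval on which the weights of a given type live. -/
def ClassicalType.interval : ClassicalType → Set ℝ
  | .hermite => Set.univ
  | .laguerre => Set.Ioi 0
  | .jacobi => Set.Ioo (-1) 1

/-- The classical scalar weights of each type, given by their parameters. -/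
inductive ClassicalWeight : ClassicalType → Type
  | hermite (b : ℝ) : ClassicalWeight .hermite
  | laguerre (α : ℝ) (hα : -1 < α) : ClassicalWeight .laguerre
  | jacobi (α β : ℝ) (hα : -1 < α) (hβ : -1 < β) : ClassicalWeight .jacobi

namespace ClassicalWeight

/-- The weight function: `e^{-x^2+2bx}`, `e^{-x} x^α`, `(1-x)^α (1+x)^β`. -/
def fn : {t : ClassicalType} → ClassicalWeight t → ℝ → ℝ
  | _, hermite b => fun x => Real.exp (-x ^ 2 + 2 * b * x)
  | _, laguerre α _ => fun x => Real.exp (-x) * x ^ α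
  | _, jacobi α β _ _ => fun x => (1 - x) ^ α * (1 + x) ^ β

open WeylAlgebra in
/-- The second-order operator: `∂² - 2 ∂ (x - b)`, `∂² x + ∂ (α + 1 - x)`,
`∂² (1 - x²) + ∂ (β - α - x (α + β + 2))`. -/
def delta : {t : ClassicalType} → ClassicalWeight t → WeylAlgebra
  | _, hermite b => dx ^ 2 - 2 * (dx * mulBy (X - C (b : ℂ)))
  | _, laguerre α _ => dx ^ 2 * mulBy X + dx * mulBy (C ((α : ℂ) + 1) - X)
  | _, jacobi α β _ _ => dx ^ 2 * mulBy (1 - X ^ 2) +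
      dx * mulBy (C ((β : ℂ) - α) - X * C ((α : ℂ) + β + 2))

theorem isOpen_interval (t : ClassicalType) : IsOpen t.interval := by
  cases t
  · exact isOpen_univ
  · exact isOpen_Ioi
  · exact isOpen_Ioo

theorem ordConnected_interval (t : ClassicalType) : t.interval.OrdConnected := by
  cases t
  · exact Set.ordConnected_univ
  · exact Set.ordConnected_Ioi
  · exact Set.ordConnected_Ioo

theorem nonempty_interval (t : ClassicalType) : t.interval.Nonempty := by
  cases t
  · exact Set.univ_nonempty
  · exact Set.nonempty_Ioi
  · exact Set.nonempty_Ioo.2 (by norm_num)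

theorem fn_pos {t : ClassicalType} (w : ClassicalWeight t) {x : ℝ} (hx : x ∈ t.interval) :
    0 < w.fn x := by
  cases w with
  | hermite b => exact Real.exp_pos _
  | laguerre α hα => exact mul_pos (Real.exp_pos _) (Real.rpow_pos_of_pos hx _)
  | jacobi α β hα hβ =>
    exact mul_pos (Real.rpow_pos_of_pos (by linarith [hx.2]) _)
      (Real.rpow_pos_of_pos (by linarith [hx.1]) _)

theorem fn_smooth {t : ClassicalType} (w : ClassicalWeight t) :
    ContDiffOn ℝ ∞ w.fn t.interval := by
  cases w with
  | hermite b =>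
    refine ContDiff.contDiffOn ?_
    unfold fn
    fun_prop
  | laguerre α hα =>
    intro x hx
    have h0 : x ≠ 0 := ne_of_gt hx
    refine ContDiffAt.contDiffWithinAt ?_
    exact ContDiffAt.mul (by fun_prop) (contDiffAt_id.rpow_const_of_ne h0)
  | jacobi α β hα hβ =>
    intro x hx
    have h1 : (1 - x) ≠ 0 := ne_of_gt (by linarith [hx.2])
    have h2 : (1 + x) ≠ 0 := ne_of_gt (by linarith [hx.1])
    refine ContDiffAt.contDiffWithinAt ?_
    exact ContDiffAt.mul (ContDiffAt.rpow_const_of_ne (by fun_prop) h1)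
      (ContDiffAt.rpow_const_of_ne (by fun_prop) h2)

theorem fn_moments {t : ClassicalType} (w : ClassicalWeight t) (n : ℕ) :
    IntegrableOn (fun x : ℝ => x ^ n * w.fn x) t.interval := by
  cases w with
  | hermite b =>
    have h0 : ∀ k : ℕ, Integrable fun y : ℝ => y ^ k * Real.exp (-1 * y ^ 2) := fun k => by
      simpa using integrable_rpow_mul_exp_neg_mul_sq one_pos
        (s := (k : ℝ)) (by linarith [k.cast_nonneg (α := ℝ)])
    have h1 : Integrable fun y : ℝ => (y + b) ^ n * Real.exp (-1 * y ^ 2) := by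
      simp only [add_pow, Finset.sum_mul]
      refine integrable_finsetSum _ fun k _ => ?_
      refine ((h0 k).mul_const (b ^ (n - k) * n.choose k)).congr (Filter.Eventually.of_forall ?_)
      intro y
      simp only
      ring
    refine (((h1.comp_sub_right b).mul_const (Real.exp (b ^ 2))).congr
      (Filter.Eventually.of_forall ?_)).integrableOn
    intro x
    simp only [sub_add_cancel, fn, mul_assoc, ← Real.exp_add]
    ring_nf
  | laguerre α hα =>
    have h := Real.GammaIntegral_convergent (s := n + α + 1)
      (by linarith [n.cast_nonneg (α := ℝ)])
    refine h.congr_fun ?_ measurableSet_Ioi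
    intro x hx
    simp only [fn, add_sub_cancel_right]
    rw [Real.rpow_add hx, Real.rpow_natCast]
    ring
  | jacobi α β hα hβ =>
    have hl : IntervalIntegrable (fun x : ℝ => (1 + x) ^ β * (x ^ n * (1 - x) ^ α))
        volume (-1) 0 := by
      refine IntervalIntegrable.mul_continuousOn ?_ ?_
      · have := (intervalIntegral.intervalIntegrable_rpow' hβ (a := 0) (b := 1)).comp_add_left 1
        simpa using this
      · rw [Set.uIcc_of_le (by norm_num)]
        refine (continuousOn_pow n).mul (ContinuousOn.rpow_const (by fun_prop) ?_)
        exact fun x hx => Or.inl (by linarith [hx.2])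
    have hr : IntervalIntegrable (fun x : ℝ => (1 - x) ^ α * (x ^ n * (1 + x) ^ β))
        volume 0 1 := by
      refine IntervalIntegrable.mul_continuousOn ?_ ?_
      · have := (intervalIntegral.intervalIntegrable_rpow' hα (a := 1) (b := 0)).comp_sub_left 1
        simpa using this
      · rw [Set.uIcc_of_le (by norm_num)]
        refine (continuousOn_pow n).mul (ContinuousOn.rpow_const (by fun_prop) ?_)
        exact fun x hx => Or.inl (by linarith [hx.1])
    have hl' : IntervalIntegrable (fun x : ℝ => x ^ n * ((1 - x) ^ α * (1 + x) ^ β))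
        volume (-1) 0 := by
      convert hl using 2
      ring
    have hr' : IntervalIntegrable (fun x : ℝ => x ^ n * ((1 - x) ^ α * (1 + x) ^ β))
        volume 0 1 := by
      convert hr using 2
      ring
    exact (intervalIntegrable_iff_integrableOn_Ioo_of_le (by norm_num)).1 (hl'.trans hr')

/-- The direct sum `w_1 ⊕ ⋯ ⊕ w_N` of classical scalar weights of the same type. -/
def directSum {t : ClassicalType} {ι : Type*} [Fintype ι] [DecidableEq ι]
    (w : ι → ClassicalWeight t) : WeightMatrix t.interval ι where
  toFun x := Matrix.diagonal fun i => (((w i).fn x : ℝ) : ℂ)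
  isOpen := isOpen_interval t
  ordConnected := ordConnected_interval t
  nonempty := nonempty_interval t
  smooth := by
    intro i j
    by_cases h : i = j
    · subst h
      simp only [Matrix.diagonal_apply_eq]
      exact Complex.ofRealCLM.contDiff.comp_contDiffOn (fn_smooth (w i))
    · simp only [Matrix.diagonal_apply_ne _ h]
      exact contDiffOn_const
  posDef := by
    refine (ae_restrict_iff' (isOpen_interval t).measurableSet).2 (Filter.Eventually.of_forall ?_)
    intro x hx
    exact Matrix.PosDef.diagonal fun i => by exact_mod_cast fn_pos (w i) hx
  moments := by
    intro n i j
    by_cases h : i = j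
    · subst h
      simp only [Matrix.diagonal_apply_eq]
      exact_mod_cast (fn_moments (w i) n).ofReal (𝕜 := ℂ)
    · simp only [Matrix.diagonal_apply_ne _ h, mul_zero]
      exact integrableOn_zero

/-- A classical scalar weight as a weight matrix of size one. -/
def weight {t : ClassicalType} (w : ClassicalWeight t) : WeightMatrix t.interval Unit :=
  directSum fun _ => w

end ClassicalWeight

end

noncomputable section

/-! ### Scalar operators and their values on monic sequences -/

namespace WeylAlgebra

/-! Each `δ_j` has one monic eigenpolynomial in every degree, with pairwise distinct eigenvalues
`λ_n`. Since `δ_j` is symmetric for `w_j`, these are the orthogonal polynomials. An operator is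
determined by its values on them, so the algebra of the direct sum consists of the matrices whose
`(i, j)` entry sends the `n`-th polynomial of `w_i` to a multiple of the `n`-th polynomial of `w_j`
(`mem_diffAlgebra_directSum`). Questions about operators thus become questions about scalar
sequences in `n`.

Two scalar facts carry the proof. The first is `𝒟(w) = ℂ[δ]`, in the form
`exists_eigenvalue_eq_eval`. The eigenvalue of any operator in `𝒟(w)` is a polynomial in `n`; this
suffices for Hermite and Laguerre, where `λ_n` is linear in `n`. For Jacobi, `λ_n = -n(n+s)` with `s
= α+β+1`. There the top coefficient `f` of an order `m` operator commuting with `δ` satisfies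
`(1-x²)f' = -m x f`, so it is a multiple of `(1-x²)^(m/2)`. The eigenvalue polynomial therefore has
even degree, and its leading term can be removed by a power of `δ`.

The second is that Darboux equivalent weights have equal eigenvalues
(`eigenvalue_eq_of_intertwine`): otherwise a difference `λ_n - λ'_n`, linear in `n`, would produce
an odd-degree polynomial in `n` equal to a polynomial in `n(n+s)`.

Now a central `D` commutes with the diagonal idempotents, so it is diagonal. It commutes with the
Darboux intertwiners placed off the diagonal, so all its diagonal entries have the same eigenvalue
sequence, which is `p(λ_n)` for a single `p`. Conversely, `diag(p(δ_j))` is central because `λ_n`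
does not depend on `j`. -/

theorem act_add_left (p q : ℂ[X]) (D : WeylAlgebra) : act (p + q) D = act p D + act q D :=
  map_add _ p q

theorem act_smul_left (c : ℂ) (p : ℂ[X]) (D : WeylAlgebra) : act (c • p) D = c • act p D :=
  map_smul _ c p

theorem act_zero_left (D : WeylAlgebra) : act 0 D = 0 := map_zero _

theorem act_sub_left (p q : ℂ[X]) (D : WeylAlgebra) : act (p - q) D = act p D - act q D :=
  map_sub _ p q

theorem act_zero (p : ℂ[X]) : act p 0 = 0 := (rfl)

theorem act_one (p : ℂ[X]) : act p 1 = p := (rfl)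

theorem act_add (p : ℂ[X]) (D E : WeylAlgebra) : act p (D + E) = act p D + act p E := (rfl)

theorem act_sub (p : ℂ[X]) (D E : WeylAlgebra) : act p (D - E) = act p D - act p E := (rfl)

theorem act_mul (p : ℂ[X]) (D E : WeylAlgebra) : act p (D * E) = act (act p D) E := (rfl)

theorem act_algebraMap (p : ℂ[X]) (c : ℂ) : act p (algebraMap ℂ WeylAlgebra c) = c • p := (rfl)

theorem act_dx (p : ℂ[X]) : act p dx = derivative p := (rfl)

theorem act_mulBy (p f : ℂ[X]) : act p (mulBy f) = p * f := (rfl)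

theorem ext_act {D E : WeylAlgebra} (h : ∀ p, act p D = act p E) : D = E :=
  Subtype.ext (MulOpposite.unop_injective (LinearMap.ext h))

theorem exists_act_eq_sum (D : WeylAlgebra) : ∃ (m : ℕ) (f : ℕ → ℂ[X]), ∀ p : ℂ[X],
    act p D = ∑ j ∈ Finset.range m, derivative^[j] p * f j := D.2

/-- An eigenvector of `D` is an eigenvector of every polynomial in `D`. -/
theorem act_aeval {p : ℂ[X]} {D : WeylAlgebra} {c : ℂ} (h : act p D = c • p) (q : ℂ[X]) :
    act p (aeval D q) = q.eval c • p := by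
  induction q using Polynomial.induction_on' with
  | add a b ha hb => rw [map_add, act_add, ha, hb, eval_add, add_smul]
  | monomial n a =>
    have hpow : ∀ n : ℕ, act p (D ^ n) = c ^ n • p := by
      intro n
      induction n with
      | zero => simp [act_one]
      | succ n ih => rw [pow_succ, act_mul, ih, act_smul_left, h, smul_smul, pow_succ]
    rw [aeval_monomial, act_mul, act_algebraMap, act_smul_left, hpow, eval_monomial, smul_smul]

end WeylAlgebra

/-- A sequence of monic polynomials, one in each degree, allows for induction on polynomials. -/
theorem Polynomial.induction_on_monic_sequence {p : ℕ → ℂ[X]} (hm : ∀ n, (p n).Monic)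
    (hd : ∀ n, (p n).natDegree = n) (n : ℕ) {M : ℂ[X] → Prop} (hzero : M 0)
    (hadd : ∀ (m : ℕ) (c : ℂ) (q : ℂ[X]), m < n → M q → M (c • p m + q))
    (q : ℂ[X]) (hq : q.degree < n) : M q := by
  induction n generalizing q with
  | zero =>
    have h0 : q = 0 := by
      ext k
      exact (degree_lt_iff_coeff_zero q 0).1 hq k k.zero_le
    rw [h0]; exact hzero
  | succ n ih =>
    have hn : q.natDegree ≤ n := by
      by_cases h0 : q = 0
      · simp [h0]
      · exact Nat.lt_succ_iff.1 ((natDegree_lt_iff_degree_lt h0).2 hq)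
    have h1 : (q - q.coeff n • p n).degree < n := by
      rw [degree_lt_iff_coeff_zero]
      intro k hk
      rcases hk.eq_or_lt with rfl | hk
      · have := (hm n).coeff_natDegree
        rw [hd] at this
        simp [this]
      · rw [coeff_sub, coeff_smul, coeff_eq_zero_of_natDegree_lt (hn.trans_lt hk),
          coeff_eq_zero_of_natDegree_lt ((hd n).trans_lt hk)]
        simp
    have := hadd n (q.coeff n) _ n.lt_succ_self
      (ih (fun m c q hm => hadd m c q (hm.trans n.lt_succ_self)) _ h1)
    rwa [add_sub_cancel] at this

/-- Operators that agree on one monic polynomial in each degree are equal. -/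
theorem WeylAlgebra.ext_monic_sequence {p : ℕ → ℂ[X]} (hm : ∀ n, (p n).Monic)
    (hd : ∀ n, (p n).natDegree = n) {D E : WeylAlgebra} (h : ∀ n, act (p n) D = act (p n) E) :
    D = E := by
  refine ext_act fun q => ?_
  refine Polynomial.induction_on_monic_sequence hm hd (q.natDegree + 1)
    (M := fun q => act q D = act q E) ((act_zero_left D).trans (act_zero_left E).symm) ?_ q ?_
  · intro m c q _ hq
    rw [act_add_left, act_add_left, act_smul_left, act_smul_left, h, hq]
  · exact degree_le_natDegree.trans_lt (by exact_mod_cast Nat.lt_succ_self _)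

/-! ### Eigenvalues and eigenpolynomials of `δ` -/

namespace ClassicalWeight

open WeylAlgebra

variable {t : ClassicalType} (w : ClassicalWeight t)

/-- The coefficient of `∂²` in `δ`. -/
def lead : {t : ClassicalType} → ClassicalWeight t → ℂ[X]
  | _, hermite _ => 1
  | _, laguerre _ _ => X
  | _, jacobi _ _ _ _ => 1 - X ^ 2

/-- The coefficient of `∂` in `δ`. -/
def drift : {t : ClassicalType} → ClassicalWeight t → ℂ[X]
  | _, hermite b => -2 * (X - C (b : ℂ))
  | _, laguerre α _ => C ((α : ℂ) + 1) - X
  | _, jacobi α β _ _ => C ((β : ℂ) - α) - X * C ((α : ℂ) + β + 2)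

theorem act_delta (p : ℂ[X]) :
    act p w.delta = derivative (derivative p) * w.lead + derivative p * w.drift := by
  cases w with
  | hermite b =>
    have h2 : ∀ q, act q 2 = 2 * q := fun q => by
      rw [← one_add_one_eq_two, act_add, act_one, two_mul]
    simp only [delta, pow_two, act_sub, act_mul, act_dx, act_mulBy, h2, lead, drift,
      derivative_mul, derivative_ofNat]
    ring
  | laguerre α hα => simp only [delta, pow_two, act_add, act_mul, act_dx, act_mulBy, lead, drift]
  | jacobi α β hα hβ =>
    simp only [delta, pow_two (dx), act_add, act_mul, act_dx, act_mulBy, lead, drift]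

theorem natDegree_lead_le : w.lead.natDegree ≤ 2 := by
  cases w <;> simp only [lead] <;> compute_degree <;> norm_num

theorem natDegree_drift_le : w.drift.natDegree ≤ 1 := by
  cases w <;> simp only [drift] <;> compute_degree

/-- The eigenvalue of `δ` on polynomials of degree `n`. -/
def eigenvalue (n : ℕ) : ℂ := n * (n - 1) * w.lead.coeff 2 + n * w.drift.coeff 1

theorem eigenvalue_hermite (b : ℝ) (n : ℕ) : (hermite b).eigenvalue n = -2 * n := by
  have : (-2 * (X - C (b : ℂ))).coeff 1 = -2 := by
    rw [show (-2 : ℂ[X]) = C (-2) by rw [C_neg, C_ofNat], coeff_C_mul, coeff_sub, coeff_X_one,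
      coeff_C_of_ne_zero one_ne_zero]
    ring
  simp [eigenvalue, lead, drift, this, coeff_one, mul_comm, -neg_mul]

theorem eigenvalue_laguerre (α : ℝ) (hα : -1 < α) (n : ℕ) :
    (laguerre α hα).eigenvalue n = -n := by
  have : (C ((α : ℂ) + 1)).coeff 1 = 0 := coeff_C_of_ne_zero one_ne_zero
  simp only [eigenvalue, lead, drift, coeff_sub, this, coeff_X]
  simp

theorem eigenvalue_jacobi (α β : ℝ) (hα : -1 < α) (hβ : -1 < β) (n : ℕ) :
    (jacobi α β hα hβ).eigenvalue n = -n * (n + (α + β + 1)) := by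
  have h1 : (X * C ((α : ℂ) + β + 2)).coeff 1 = (α : ℂ) + β + 2 := by
    rw [coeff_mul_C, coeff_X_one, one_mul]
  have h2 : (C ((β : ℂ) - α)).coeff 1 = 0 := coeff_C_of_ne_zero one_ne_zero
  simp only [eigenvalue, lead, drift, coeff_sub, h1, h2, coeff_X_pow, coeff_one]
  simp
  ring

theorem eigenvalue_injective : Function.Injective w.eigenvalue := by
  intro m n h
  cases w with
  | hermite b => simpa [eigenvalue_hermite] using h
  | laguerre α hα => simpa [eigenvalue_laguerre] using h
  | jacobi α β hα hβ =>
    simp only [eigenvalue_jacobi] at h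
    by_contra hmn
    have h' : (m : ℝ) * (m + (α + β + 1)) = n * (n + (α + β + 1)) := by
      have : (m : ℂ) * (m + (α + β + 1)) = n * (n + (α + β + 1)) := by linear_combination -h
      exact_mod_cast this
    have h1 : ((m : ℝ) - n) * (m + n + (α + β + 1)) = 0 := by linear_combination h'
    rcases mul_eq_zero.1 h1 with h2 | h2
    · exact hmn (by exact_mod_cast sub_eq_zero.1 h2)
    -- Distinct indices have `m + n ≥ 1`, while `α + β + 1 > -1`, so the second factor is positive.
    · have : (1 : ℝ) ≤ m + n := by exact_mod_cast (by omega : 1 ≤ m + n)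
      linarith

theorem act_delta_degree {p : ℂ[X]} {n : ℕ} (hp : p.natDegree ≤ n) :
    (act p w.delta).natDegree ≤ n ∧ (act p w.delta).coeff n = w.eigenvalue n * p.coeff n := by
  have h1 := natDegree_derivative_le p
  have h2 := natDegree_derivative_le (derivative p)
  have ha := w.natDegree_lead_le
  have hb := w.natDegree_drift_le
  rw [act_delta]
  match n, hp with
  | 0, hp =>
    have : derivative p = 0 := derivative_of_natDegree_zero (by omega)
    simp [this, eigenvalue]
  | 1, hp =>
    have h0 : derivative (derivative p) = 0 := derivative_of_natDegree_zero (by omega)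
    have h1' : (derivative p).natDegree ≤ 0 := by omega
    rw [h0, zero_mul, zero_add]
    refine ⟨natDegree_mul_le.trans (by omega), ?_⟩
    rw [show 1 = 0 + 1 from rfl, coeff_mul_add_eq_of_natDegree_le h1' hb, coeff_derivative]
    simp [eigenvalue, mul_comm]
  | k + 2, hp =>
    have h1' : (derivative p).natDegree ≤ k + 1 := by omega
    have h2' : (derivative (derivative p)).natDegree ≤ k := by omega
    refine ⟨natDegree_add_le_of_degree_le (natDegree_mul_le.trans (by omega))
      (natDegree_mul_le.trans (by omega)), ?_⟩
    rw [coeff_add, coeff_mul_add_eq_of_natDegree_le h2' ha, show k + 2 = k + 1 + 1 from rfl,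
      coeff_mul_add_eq_of_natDegree_le h1' hb, coeff_derivative, coeff_derivative]
    simp only [eigenvalue]
    push_cast
    ring

theorem eq_eigenvalue_of_act_delta {p : ℂ[X]} (hp : p ≠ 0) {c : ℂ}
    (h : act p w.delta = c • p) : c = w.eigenvalue p.natDegree := by
  have := (w.act_delta_degree le_rfl (p := p)).2
  rw [h, coeff_smul, smul_eq_mul] at this
  exact mul_right_cancel₀ (by simpa using hp) this

/-- On polynomials of degree less than `n`, the operator `δ - λ_n` is injective because the
eigenvalues are distinct, hence surjective by finite dimension. It sends `X ^ n` into this space, so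
a lower-degree correction of `X ^ n` lies in its kernel. -/
theorem exists_eigenpolynomial (n : ℕ) : ∃ p : ℂ[X], p.Monic ∧ p.natDegree = n ∧
    act p w.delta = w.eigenvalue n • p := by
  let T : ℂ[X] →ₗ[ℂ] ℂ[X] := w.delta.1.unop - w.eigenvalue n • LinearMap.id
  have hT : ∀ p, T p = act p w.delta - w.eigenvalue n • p := fun p => rfl
  have hmaps : ∀ p ∈ degreeLT ℂ n, T p ∈ degreeLT ℂ n := by
    intro p hp
    rw [mem_degreeLT] at hp
    refine Submodule.sub_mem _ ?_ (Submodule.smul_mem _ _ (mem_degreeLT.2 hp))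
    rcases eq_or_ne p 0 with rfl | h0
    · rw [map_zero]
      exact Submodule.zero_mem _
    · refine mem_degreeLT.2 (degree_le_natDegree.trans_lt ?_)
      have h1 := (w.act_delta_degree le_rfl (p := p)).1
      have h2 := (natDegree_lt_iff_degree_lt h0).2 hp
      exact_mod_cast h1.trans_lt h2
  have : FiniteDimensional ℂ (degreeLT ℂ n) :=
    LinearEquiv.finiteDimensional (degreeLTEquiv ℂ n).symm
  have hinj : Function.Injective (T.restrict hmaps) := by
    rw [injective_iff_map_eq_zero]
    rintro ⟨p, hp⟩ h
    by_contra hne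
    have h0 : p ≠ 0 := fun h0 => hne (Subtype.ext h0)
    have h' : T p = 0 := congrArg Subtype.val h
    have := w.eigenvalue_injective (w.eq_eigenvalue_of_act_delta h0 (sub_eq_zero.1 h'))
    have := (natDegree_lt_iff_degree_lt h0).2 (mem_degreeLT.1 hp)
    omega
  have hX : T (X ^ n) ∈ degreeLT ℂ n := by
    rw [mem_degreeLT, degree_lt_iff_coeff_zero]
    intro k hk
    have hXn : (X ^ n : ℂ[X]).natDegree ≤ n := natDegree_X_pow_le n
    have h1 := w.act_delta_degree hXn
    rw [hT, coeff_sub, coeff_smul]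
    rcases hk.eq_or_lt with rfl | hk
    · rw [h1.2]; simp
    · rw [coeff_eq_zero_of_natDegree_lt (h1.1.trans_lt hk),
        coeff_eq_zero_of_natDegree_lt (hXn.trans_lt hk)]
      simp
  obtain ⟨⟨r, hr⟩, hr'⟩ := LinearMap.surjective_of_injective hinj ⟨_, hX⟩
  have hr'' : T r = T (X ^ n) := congrArg Subtype.val hr'
  rw [mem_degreeLT] at hr
  have hmon : (X ^ n - r).Monic := monic_X_pow_sub hr
  refine ⟨X ^ n - r, hmon, ?_, ?_⟩
  · have : (X ^ n - r).degree = (n : WithBot ℕ) := by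
      rw [degree_sub_eq_left_of_degree_lt (by rwa [degree_X_pow]), degree_X_pow]
    exact natDegree_eq_of_degree_eq_some this
  · rw [← sub_eq_zero, ← hT, map_sub, hr'', sub_self]

/-- The monic eigenpolynomial of `δ` of degree `n`. -/
def opoly (n : ℕ) : ℂ[X] := (w.exists_eigenpolynomial n).choose

theorem opoly_monic (n : ℕ) : (w.opoly n).Monic := (w.exists_eigenpolynomial n).choose_spec.1

theorem natDegree_opoly (n : ℕ) : (w.opoly n).natDegree = n :=
  (w.exists_eigenpolynomial n).choose_spec.2.1

theorem act_opoly_delta (n : ℕ) : act (w.opoly n) w.delta = w.eigenvalue n • w.opoly n :=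
  (w.exists_eigenpolynomial n).choose_spec.2.2

theorem opoly_ne_zero (n : ℕ) : w.opoly n ≠ 0 := (w.opoly_monic n).ne_zero

theorem coeff_opoly (n : ℕ) : (w.opoly n).coeff n = 1 := by
  have := (w.opoly_monic n).coeff_natDegree
  rwa [natDegree_opoly] at this

theorem act_opoly_aeval_delta (n : ℕ) (q : ℂ[X]) :
    act (w.opoly n) (aeval w.delta q) = q.eval (w.eigenvalue n) • w.opoly n :=
  act_aeval (w.act_opoly_delta n) q

end ClassicalWeight

/-! ### Orthogonality with respect to the classical weights -/

theorem Polynomial.eval_map_conj (p : ℂ[X]) (x : ℝ) :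
    (p.map (starRingEnd ℂ)).eval (x : ℂ) = starRingEnd ℂ (p.eval (x : ℂ)) := by
  have := eval_map_apply (p := p) (starRingEnd ℂ) (x : ℂ)
  rwa [Complex.conj_ofReal] at this

theorem Polynomial.hasDerivAt_eval_ofReal (p : ℂ[X]) (x : ℝ) :
    HasDerivAt (fun x : ℝ => p.eval (x : ℂ)) ((derivative p).eval (x : ℂ)) x :=
  (p.hasDerivAt (x : ℂ)).comp_ofReal

namespace ClassicalWeight

open WeylAlgebra

variable {t : ClassicalType} (w : ClassicalWeight t)

theorem integrableOn_eval_mul_fn (f : ℂ[X]) :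
    IntegrableOn (fun x : ℝ => f.eval (x : ℂ) * (w.fn x : ℂ)) t.interval := by
  induction f using Polynomial.induction_on' with
  | add p q hp hq =>
    simp only [eval_add, add_mul]
    exact hp.add hq
  | monomial n a =>
    have h := ((w.fn_moments n).ofReal (𝕜 := ℂ)).const_mul a
    refine h.congr (Filter.Eventually.of_forall fun x => ?_)
    simp [mul_assoc]

/-- The integral of a polynomial against the weight. -/
def moment (f : ℂ[X]) : ℂ := ∫ x in t.interval, f.eval (x : ℂ) * (w.fn x : ℂ)

theorem moment_add (f g : ℂ[X]) : w.moment (f + g) = w.moment f + w.moment g := by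
  simp only [moment, eval_add, add_mul]
  exact integral_add (w.integrableOn_eval_mul_fn f) (w.integrableOn_eval_mul_fn g)

theorem moment_smul (c : ℂ) (f : ℂ[X]) : w.moment (c • f) = c * w.moment f := by
  simp only [moment, eval_smul, smul_eq_mul, mul_assoc]
  exact integral_const_mul c _

theorem moment_zero : w.moment 0 = 0 := by simp [moment]

/-- The integrand is `|f|² w ≥ 0`, so a zero integral forces `f = 0` almost everywhere on an
interval of positive measure, whereas a nonzero polynomial has finitely many zeros. -/
theorem eq_zero_of_moment_mul_conj {f : ℂ[X]} (h : w.moment (f * f.map (starRingEnd ℂ)) = 0) :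
    f = 0 := by
  have heq : ∀ x : ℝ, (f * f.map (starRingEnd ℂ)).eval (x : ℂ) * (w.fn x : ℂ) =
      ((‖f.eval (x : ℂ)‖ ^ 2 * w.fn x : ℝ) : ℂ) := by
    intro x
    rw [eval_mul, eval_map_conj, Complex.mul_conj, Complex.normSq_eq_norm_sq]
    push_cast
    ring
  have hint : IntegrableOn (fun x : ℝ => ‖f.eval (x : ℂ)‖ ^ 2 * w.fn x) t.interval := by
    have := (w.integrableOn_eval_mul_fn (f * f.map (starRingEnd ℂ))).re
    refine this.congr (Filter.Eventually.of_forall fun x => ?_)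
    simp only [heq]
    exact Complex.ofReal_re _
  have hmeas := (isOpen_interval t).measurableSet
  simp only [moment, heq] at h
  rw [integral_complex_ofReal, Complex.ofReal_eq_zero, setIntegral_eq_zero_iff_of_nonneg_ae
    ((ae_restrict_iff' hmeas).2 (Filter.Eventually.of_forall fun x hx =>
      mul_nonneg (sq_nonneg _) (w.fn_pos hx).le)) hint] at h
  by_contra hf
  have hroots : {x : ℝ | f.eval (x : ℂ) = 0}.Finite := by
    refine Set.Finite.preimage (f := ((↑) : ℝ → ℂ)) Complex.ofReal_injective.injOn
      (s := {z : ℂ | f.eval z = 0}) ?_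
    exact f.finite_setOfPred_isRoot hf
  have h1 : ∀ᵐ x : ℝ ∂volume.restrict t.interval, f.eval (x : ℂ) = 0 := by
    have := (ae_restrict_iff' hmeas).1 h
    refine (ae_restrict_iff' hmeas).2 (this.mono fun x hx hxI => ?_)
    have h2 := hx hxI
    simpa [(w.fn_pos hxI).ne'] using h2
  have h2 : ∀ᵐ x : ℝ ∂volume.restrict t.interval, ¬ f.eval (x : ℂ) = 0 := by
    refine ae_restrict_of_ae ?_
    rw [ae_iff]
    simpa using hroots.measure_zero volume
  have h3 : volume.restrict t.interval = 0 := by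
    rw [← ae_eq_bot, ← Filter.eventually_false_iff_eq_bot]
    exact (h1.and h2).mono fun x hx => hx.2 hx.1
  rw [Measure.restrict_eq_zero] at h3
  exact ((isOpen_interval t).measure_pos volume (nonempty_interval t)).ne' h3

/-- The Pearson equation `(a w)' = b w`. -/
theorem hasDerivAt_lead_mul_fn {x : ℝ} (hx : x ∈ t.interval) :
    HasDerivAt (fun x : ℝ => w.lead.eval (x : ℂ) * (w.fn x : ℂ))
      (w.drift.eval (x : ℂ) * (w.fn x : ℂ)) x := by
  cases w with
  | hermite b =>
    have h : HasDerivAt (fun x : ℝ => Real.exp (-x ^ 2 + 2 * b * x))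
        (Real.exp (-x ^ 2 + 2 * b * x) * (-(2 * x) + 2 * b)) x := by
      refine HasDerivAt.exp ?_
      convert! ((hasDerivAt_pow 2 x).neg).add ((hasDerivAt_id x).const_mul (2 * b)) using 1
      simp
    convert h.ofReal_comp using 1
    · ext y; simp [lead, fn]
    · simp [drift, fn]; ring
  | laguerre α hα =>
    have hx0 : (0 : ℝ) < x := hx
    have h : HasDerivAt (fun x : ℝ => x * (Real.exp (-x) * x ^ α))
        (((α + 1) - x) * (Real.exp (-x) * x ^ α)) x := by
      convert! (hasDerivAt_id x).mul (((hasDerivAt_id x).neg.exp).mul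
        (Real.hasDerivAt_rpow_const (p := α) (Or.inl hx0.ne'))) using 1
      have : x ^ α = x * x ^ (α - 1) := by
        rw [Real.rpow_sub_one hx0.ne']; field_simp
      simp only [Pi.mul_apply, Pi.neg_apply, id, this]
      ring
    convert h.ofReal_comp using 1
    · ext y; simp [lead, fn]
    · simp [drift, fn]
  | jacobi α β hα hβ =>
    have h1 : (0 : ℝ) < 1 - x := by linarith [hx.2]
    have h2 : (0 : ℝ) < 1 + x := by linarith [hx.1]
    have h : HasDerivAt (fun x : ℝ => (1 - x ^ 2) * ((1 - x) ^ α * (1 + x) ^ β))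
        (((β - α) - x * (α + β + 2)) * ((1 - x) ^ α * (1 + x) ^ β)) x := by
      convert! ((hasDerivAt_pow 2 x).const_sub 1).mul
        ((((hasDerivAt_id x).const_sub 1).rpow_const (p := α) (Or.inl h1.ne')).mul
        (((hasDerivAt_id x).const_add 1).rpow_const (p := β) (Or.inl h2.ne'))) using 1
      have e1 : (1 - x) ^ α = (1 - x) * (1 - x) ^ (α - 1) := by
        rw [Real.rpow_sub_one h1.ne']; field_simp
      have e2 : (1 + x) ^ β = (1 + x) * (1 + x) ^ (β - 1) := by
        rw [Real.rpow_sub_one h2.ne']; field_simp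
      simp only [Pi.mul_apply, id, e1, e2]
      push_cast
      ring
    convert h.ofReal_comp using 1
    · ext y; simp [lead, fn]
    · simp [drift, fn]

theorem hasDerivAt_mul_lead_mul_fn (r : ℂ[X]) {x : ℝ} (hx : x ∈ t.interval) :
    HasDerivAt (fun x : ℝ => (r * w.lead).eval (x : ℂ) * (w.fn x : ℂ))
      ((derivative r * w.lead + r * w.drift).eval (x : ℂ) * (w.fn x : ℂ)) x := by
  convert! (r.hasDerivAt_eval_ofReal x).mul (w.hasDerivAt_lead_mul_fn hx) using 1
  · ext y; simp [mul_assoc]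
  · simp; ring

/-- By the Pearson equation the integrand is the derivative of `r a w`, with `a` the coefficient of
`∂²`, and the boundary values of `r a w` vanish. -/
theorem moment_total_derivative (r : ℂ[X]) :
    w.moment (derivative r * w.lead + r * w.drift) = 0 := by
  have hd := fun x (hx : x ∈ t.interval) => w.hasDerivAt_mul_lead_mul_fn r hx
  have hi := w.integrableOn_eval_mul_fn (r * w.lead)
  have hi' := w.integrableOn_eval_mul_fn (derivative r * w.lead + r * w.drift)
  cases w with
  | hermite b =>
    simp only [moment, ClassicalType.interval, setIntegral_univ]
    simp only [ClassicalType.interval, integrableOn_univ] at hi hi'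
    exact integral_eq_zero_of_hasDerivAt_of_integrable (fun x => hd x (Set.mem_univ x)) hi' hi
  | laguerre α hα =>
    -- Absorbing `x` into the weight gives the exponent `α + 1 > 0`, so the primitive extends
    -- continuously by zero to the endpoint even when `α < 0`. At infinity it tends to zero because
    -- it and its derivative are integrable.
    have hext : ∀ x : ℝ, 0 < x → r.eval (x : ℂ) * ((Real.exp (-x) * x ^ (α + 1) : ℝ) : ℂ) =
        (r * (laguerre α hα).lead).eval (x : ℂ) * ((laguerre α hα).fn x : ℂ) := by
      intro x hx
      simp only [lead, fn, Real.rpow_add_one hx.ne', eval_mul, eval_X]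
      push_cast
      ring
    have hd' : ∀ x ∈ Set.Ioi (0 : ℝ), HasDerivAt
        (fun x : ℝ => r.eval (x : ℂ) * ((Real.exp (-x) * x ^ (α + 1) : ℝ) : ℂ)) _ x :=
      fun x hx => (hd x hx).congr_of_eventuallyEq
        (Filter.mem_of_superset (Ioi_mem_nhds hx) hext)
    have hi₂ : IntegrableOn
        (fun x : ℝ => r.eval (x : ℂ) * ((Real.exp (-x) * x ^ (α + 1) : ℝ) : ℂ)) (Set.Ioi 0) :=
      hi.congr_fun (fun x hx => (hext x hx).symm) measurableSet_Ioi
    have hc : Continuous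
        (fun x : ℝ => r.eval (x : ℂ) * ((Real.exp (-x) * x ^ (α + 1) : ℝ) : ℂ)) := by
      have : Continuous fun x : ℝ => x ^ (α + 1) :=
        Real.continuous_rpow_const (by linarith)
      fun_prop
    refine (integral_Ioi_of_hasDerivAt_of_tendsto hc.continuousWithinAt hd' hi'
      (tendsto_zero_of_hasDerivAt_of_integrableOn_Ioi hd' hi' hi₂)).trans ?_
    simp [Real.zero_rpow (show α + 1 ≠ 0 by linarith)]
  | jacobi α β hα hβ =>
    -- Absorbing `1 - x²` makes both exponents positive, so the primitive is continuous and vanishes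
    -- at both endpoints.
    have hext : ∀ x : ℝ, x ∈ Set.Ioo (-1 : ℝ) 1 →
        r.eval (x : ℂ) * (((1 - x) ^ (α + 1) * (1 + x) ^ (β + 1) : ℝ) : ℂ) =
        (r * (jacobi α β hα hβ).lead).eval (x : ℂ) * ((jacobi α β hα hβ).fn x : ℂ) := by
      intro x hx
      have h1 : 1 - x ≠ 0 := by linarith [hx.2]
      have h2 : 1 + x ≠ 0 := by linarith [hx.1]
      simp only [lead, fn, Real.rpow_add_one h1, Real.rpow_add_one h2, eval_mul, eval_sub,
        eval_pow, eval_one, eval_X]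
      push_cast
      ring
    have hd' : ∀ x ∈ Set.Ioo (-1 : ℝ) 1, HasDerivAt
        (fun x : ℝ => r.eval (x : ℂ) * (((1 - x) ^ (α + 1) * (1 + x) ^ (β + 1) : ℝ) : ℂ)) _ x :=
      fun x hx => (hd x hx).congr_of_eventuallyEq
        (Filter.mem_of_superset (Ioo_mem_nhds hx.1 hx.2) hext)
    have hc : Continuous
        (fun x : ℝ => r.eval (x : ℂ) * (((1 - x) ^ (α + 1) * (1 + x) ^ (β + 1) : ℝ) : ℂ)) := by
      have h1 : Continuous fun x : ℝ => (1 - x) ^ (α + 1) :=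
        (Real.continuous_rpow_const (by linarith)).comp (by fun_prop : Continuous fun x : ℝ => 1 - x)
      have h2 : Continuous fun x : ℝ => (1 + x) ^ (β + 1) :=
        (Real.continuous_rpow_const (by linarith)).comp (by fun_prop : Continuous fun x : ℝ => 1 + x)
      fun_prop
    have h11 : (-1 : ℝ) ≤ 1 := by norm_num
    have := intervalIntegral.integral_eq_sub_of_hasDerivAt_of_le h11 hc.continuousOn hd'
      ((intervalIntegrable_iff_integrableOn_Ioo_of_le h11).2 hi')
    rw [intervalIntegral.integral_of_le h11, integral_Ioc_eq_integral_Ioo] at this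
    refine this.trans ?_
    simp [Real.zero_rpow (show α + 1 ≠ 0 by linarith), Real.zero_rpow (show β + 1 ≠ 0 by linarith)]

/-- Symmetry of `δ`: the two integrands differ by the total derivative attached to the Wronskian `p'
q - p q'`. -/
theorem moment_act_delta_mul (p q : ℂ[X]) :
    w.moment (act p w.delta * q) = w.moment (p * act q w.delta) := by
  have h := w.moment_total_derivative (derivative p * q - p * derivative q)
  have e : act p w.delta * q = p * act q w.delta +
      (derivative (derivative p * q - p * derivative q) * w.lead +
        (derivative p * q - p * derivative q) * w.drift) := by
    simp only [act_delta, derivative_sub, derivative_mul]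
    ring
  rw [e, moment_add, h, add_zero]

theorem lead_map_conj : w.lead.map (starRingEnd ℂ) = w.lead := by
  cases w <;> simp [lead]

theorem drift_map_conj : w.drift.map (starRingEnd ℂ) = w.drift := by
  cases w <;> simp [drift, Complex.conj_ofNat]

theorem conj_eigenvalue (n : ℕ) : starRingEnd ℂ (w.eigenvalue n) = w.eigenvalue n := by
  have h1 := congrArg (fun p => p.coeff 2) w.lead_map_conj
  have h2 := congrArg (fun p => p.coeff 1) w.drift_map_conj
  simp only [coeff_map] at h1 h2
  simp [eigenvalue, h1, h2]

theorem act_map_conj_delta (p : ℂ[X]) :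
    act (p.map (starRingEnd ℂ)) w.delta = (act p w.delta).map (starRingEnd ℂ) := by
  simp only [act_delta, derivative_map, Polynomial.map_add, Polynomial.map_mul, lead_map_conj,
    drift_map_conj]

theorem moment_opoly_mul_conj_opoly {m n : ℕ} (h : m ≠ n) :
    w.moment (w.opoly m * (w.opoly n).map (starRingEnd ℂ)) = 0 := by
  have h1 := w.moment_act_delta_mul (w.opoly m) ((w.opoly n).map (starRingEnd ℂ))
  rw [act_map_conj_delta, act_opoly_delta, act_opoly_delta, Polynomial.map_smul, conj_eigenvalue,
    smul_mul_assoc, mul_smul_comm, moment_smul, moment_smul] at h1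
  have h2 : w.eigenvalue m - w.eigenvalue n ≠ 0 :=
    sub_ne_zero.2 fun h' => h (w.eigenvalue_injective h')
  refine (mul_eq_zero.1 ?_).resolve_left h2
  rw [sub_mul, h1, sub_self]

/-- A polynomial of degree at most `n` orthogonal to the eigenpolynomials of lower degree is a
multiple of the eigenpolynomial of degree `n`. -/
theorem eq_smul_opoly {q : ℂ[X]} {n : ℕ} (hq : q.natDegree ≤ n)
    (h : ∀ m < n, w.moment (q * (w.opoly m).map (starRingEnd ℂ)) = 0) :
    q = q.coeff n • w.opoly n := by
  rw [← sub_eq_zero]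
  set r := q - q.coeff n • w.opoly n with hr
  have hdeg : r.degree < n := by
    rw [degree_lt_iff_coeff_zero]
    intro k hk
    rcases hk.eq_or_lt with rfl | hk
    · simp [hr, coeff_opoly]
    · rw [hr, coeff_sub, coeff_smul, coeff_eq_zero_of_natDegree_lt (hq.trans_lt hk),
        coeff_eq_zero_of_natDegree_lt ((w.natDegree_opoly n).trans_lt hk)]
      simp
  have horth : ∀ m < n, w.moment (r * (w.opoly m).map (starRingEnd ℂ)) = 0 := by
    intro m hm
    have e : r * (w.opoly m).map (starRingEnd ℂ) = q * (w.opoly m).map (starRingEnd ℂ) +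
        (-q.coeff n) • (w.opoly n * (w.opoly m).map (starRingEnd ℂ)) := by
      rw [hr, sub_mul, smul_mul_assoc, neg_smul, sub_eq_add_neg]
    rw [e, moment_add, moment_smul, h m hm, w.moment_opoly_mul_conj_opoly hm.ne', mul_zero,
      add_zero]
  -- The remainder `r` is a combination of the eigenpolynomials of degree less than `n`, to all of
  -- which it is orthogonal; hence it is orthogonal to itself.
  refine w.eq_zero_of_moment_mul_conj ?_
  refine Polynomial.induction_on_monic_sequence w.opoly_monic w.natDegree_opoly n
    (M := fun s => w.moment (r * s.map (starRingEnd ℂ)) = 0) ?_ ?_ r hdeg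
  · simp [moment_zero]
  · intro m c s hm hs
    rw [Polynomial.map_add, Polynomial.map_smul, mul_add, mul_smul_comm, moment_add, moment_smul,
      horth m hm, hs, mul_zero, add_zero]

end ClassicalWeight

/-! ### Eigenvalue polynomials and leading coefficients -/

theorem Polynomial.eq_of_eval_natCast {p q : ℂ[X]} (h : ∀ n : ℕ, p.eval (n : ℂ) = q.eval (n : ℂ)) :
    p = q := by
  refine eq_of_infinite_eval_eq p q ((Set.infinite_range_of_injective
    (Nat.cast_injective (R := ℂ))).mono ?_)
  rintro _ ⟨n, rfl⟩
  exact h n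

namespace WeylAlgebra

/-- The coefficients of a differential operator are determined by its action. -/
theorem coeff_eq_zero {m : ℕ} {g : ℕ → ℂ[X]}
    (h : ∀ p : ℂ[X], ∑ j ∈ Finset.range m, derivative^[j] p * g j = 0) {j : ℕ} (hj : j < m) :
    g j = 0 := by
  induction j using Nat.strong_induction_on with
  | _ j ih =>
    -- On `X ^ j` the terms of order above `j` vanish, and those below vanish by induction; only `j!
    -- * g j` is left.
    have h1 := h (X ^ j)
    rw [Finset.sum_eq_single j] at h1
    · rw [iterate_derivative_X_pow_eq_natCast_mul, Nat.sub_self, pow_zero, mul_one,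
        Nat.descFactorial_self, mul_eq_zero] at h1
      exact h1.resolve_left (by exact_mod_cast j.factorial_ne_zero)
    · intro i hi hij
      rcases lt_or_gt_of_ne hij with hij | hij
      · rw [ih i hij (hij.trans hj), mul_zero]
      · rw [iterate_derivative_X_pow_eq_natCast_mul, Nat.descFactorial_of_lt hij]
        simp
    · intro hj'
      exact absurd (Finset.mem_range.2 hj) hj'

theorem exists_top_coeff_ne_zero {D : WeylAlgebra} (hD : D ≠ 0) :
    ∃ (m : ℕ) (f : ℕ → ℂ[X]), f m ≠ 0 ∧
      ∀ p : ℂ[X], act p D = ∑ j ∈ Finset.range (m + 1), derivative^[j] p * f j := by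
  obtain ⟨m, f, hf⟩ := exists_act_eq_sum D
  induction m with
  | zero => exact absurd (ext_act fun p => by rw [hf, act_zero, Finset.sum_range_zero]) hD
  | succ m ih =>
    by_cases h0 : f m = 0
    · exact ih fun p => by rw [hf, Finset.sum_range_succ, h0, mul_zero, add_zero]
    · exact ⟨m, f, h0, hf⟩

end WeylAlgebra

namespace ClassicalWeight

open WeylAlgebra

variable {t : ClassicalType} (w : ClassicalWeight t)

/-- Since `D` preserves the space of polynomials of degree less than `n`, its eigenvalue is the
coefficient of `X ^ n` in `X ^ n · D`, to which `∂^j f_j` contributes `n(n-1)⋯(n-j+1)` times the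
coefficient of `X ^ j` in `f_j`. Thus the eigenvalue is a polynomial in `n`. -/
theorem eigenvalue_of_operator {D : WeylAlgebra} {c : ℕ → ℂ}
    (hD : ∀ n, act (w.opoly n) D = c n • w.opoly n) {m : ℕ} {f : ℕ → ℂ[X]}
    (hf : ∀ p : ℂ[X], act p D = ∑ j ∈ Finset.range m, derivative^[j] p * f j) (n : ℕ) :
    (∑ j ∈ Finset.range m, C ((f j).coeff j) * descPochhammer ℂ j).eval (n : ℂ) = c n := by
  have hlow : ∀ q : ℂ[X], q.degree < n → (act q D).degree < n := by
    refine Polynomial.induction_on_monic_sequence w.opoly_monic w.natDegree_opoly n ?_ ?_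
    · rw [act_zero_left, degree_zero]
      exact WithBot.bot_lt_coe n
    · intro k a q hk hq
      rw [act_add_left, act_smul_left, hD]
      refine (degree_add_le _ _).trans_lt (max_lt ?_ hq)
      refine ((degree_smul_le _ _).trans (degree_smul_le _ _)).trans_lt ?_
      rw [degree_eq_natDegree (w.opoly_ne_zero k), natDegree_opoly]
      exact_mod_cast hk
  have hr : (w.opoly n - X ^ n).degree < (n : WithBot ℕ) := by
    rw [degree_lt_iff_coeff_zero]
    intro k hk
    rcases hk.eq_or_lt with rfl | hk
    · simp [coeff_opoly]
    · rw [coeff_sub, coeff_X_pow, if_neg hk.ne',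
        coeff_eq_zero_of_natDegree_lt ((w.natDegree_opoly n).trans_lt hk), sub_zero]
  have h1 : (act (X ^ n) D).coeff n = c n := by
    have h2 := (degree_lt_iff_coeff_zero _ n).1 (hlow _ hr) n le_rfl
    rw [act_sub_left, coeff_sub, hD, coeff_smul, coeff_opoly, smul_eq_mul, mul_one] at h2
    exact (sub_eq_zero.1 h2).symm
  rw [← h1, hf, finsetSum_coeff, eval_finsetSum]
  refine Finset.sum_congr rfl fun j _ => ?_
  rw [eval_mul, eval_C, descPochhammer_eval_eq_descFactorial,
    iterate_derivative_X_pow_eq_natCast_mul, mul_assoc, ← C_eq_natCast, coeff_C_mul, mul_comm]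
  rcases le_or_gt j n with hj | hj
  · obtain ⟨k, rfl⟩ := Nat.exists_eq_add_of_le hj
    rw [Nat.add_sub_cancel_left, add_comm j k, mul_comm (X ^ k), coeff_mul_X_pow', if_pos (by omega),
      Nat.add_sub_cancel_left]
  · simp [Nat.descFactorial_of_lt hj]

theorem derivative_lead_three : derivative (derivative (derivative w.lead)) = 0 := by
  cases w <;> simp [lead]

theorem derivative_drift_two : derivative (derivative w.drift) = 0 := by
  cases w <;> simp [drift]

/-- Leibniz expansion, which stops after three terms because the coefficients of `∂²` and `∂` are at
most quadratic and linear. Recording that `e` is constant keeps the induction closed. -/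
theorem iterate_derivative_act_delta (j : ℕ) : ∃ e : ℂ[X], derivative e = 0 ∧
    ∀ p, derivative^[j] (act p w.delta) = derivative^[j + 2] p * w.lead +
      derivative^[j + 1] p * ((j : ℂ[X]) * derivative w.lead + w.drift) + derivative^[j] p * e := by
  induction j with
  | zero =>
    refine ⟨0, derivative_zero, fun p => ?_⟩
    rw [act_delta]
    simp
  | succ j ih =>
    obtain ⟨e, he, h⟩ := ih
    refine ⟨e + j * derivative (derivative w.lead) + derivative w.drift, ?_, fun p => ?_⟩
    · simp [he, derivative_lead_three, derivative_drift_two]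
    · rw [Function.iterate_succ_apply', h]
      simp only [Function.iterate_succ_apply', derivative_add, derivative_mul, he,
        derivative_natCast]
      push_cast
      ring

/-- The leading coefficient of an operator that commutes with `δ`. -/
theorem top_coeff_of_commute {D : WeylAlgebra} (hD : D * w.delta = w.delta * D) {m : ℕ}
    {f : ℕ → ℂ[X]}
    (hf : ∀ p : ℂ[X], act p D = ∑ j ∈ Finset.range (m + 1), derivative^[j] p * f j) :
    2 * w.lead * derivative (f m) = m * derivative w.lead * f m := by
  choose e _ he using w.iterate_derivative_act_delta
  -- In the commutator with `δ` the terms of order `j + 2` cancel; `A j` and `B j` are what `∂^j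
  -- f_j` leaves in orders `j + 1` and `j`. Order `m + 1` receives only `A m`, which must vanish.
  let A : ℕ → ℂ[X] := fun j => 2 * w.lead * derivative (f j) - j * derivative w.lead * f j
  let B : ℕ → ℂ[X] := fun j => w.lead * derivative (derivative (f j)) +
    w.drift * derivative (f j) - e j * f j
  have hsum : ∀ p : ℂ[X], ∑ j ∈ Finset.range (m + 1),
      (derivative^[j + 1] p * A j + derivative^[j] p * B j) = 0 := by
    intro p
    have h1 : act (act p D) w.delta = act (act p w.delta) D := by
      rw [← act_mul, ← act_mul, hD]
    rw [hf (act p w.delta), act_delta, hf p, ← sub_eq_zero] at h1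
    simp only [derivative_sum, Finset.sum_mul, ← Finset.sum_add_distrib,
      ← Finset.sum_sub_distrib] at h1
    rw [← h1]
    refine Finset.sum_congr rfl fun j _ => ?_
    rw [he]
    simp only [A, B, derivative_mul, derivative_add, ← Function.iterate_succ_apply' derivative]
    ring
  have hzero := coeff_eq_zero (m := m + 2)
    (g := fun j => (if j = 0 then 0 else A (j - 1)) + (if j < m + 1 then B j else 0))
    (fun p => by
      refine Eq.trans ?_ (hsum p)
      simp only [mul_add, Finset.sum_add_distrib]
      congr 1
      · rw [Finset.sum_range_succ']
        simp
      · rw [Finset.sum_range_succ]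
        simp only [lt_irrefl, if_false, mul_zero, add_zero]
        exact Finset.sum_congr rfl fun j hj => by rw [if_pos (Finset.mem_range.1 hj)])
    (j := m + 1) (by omega)
  simpa [A, sub_eq_zero] using hzero

end ClassicalWeight

/-- A nonzero polynomial solution of `(1 - x²) f' = - m x f` has degree `m`, and `m` is even. -/
theorem Polynomial.natDegree_eq_and_even_of_ode {f : ℂ[X]} (hf : f ≠ 0) {m : ℕ}
    (h : (1 - X ^ 2) * derivative f = -((m : ℂ[X]) * X * f)) : f.natDegree = m ∧ Even m := by
  constructor
  -- For `d = deg f`, the coefficients of `X ^ (d + 1)` give `-d = -m` after division by the leading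
  -- coefficient.
  · have h1 := congrArg (fun p => p.coeff (f.natDegree + 1)) h
    have h2 : (X * derivative f).coeff f.natDegree = f.natDegree * f.leadingCoeff := by
      rcases hd : f.natDegree with _ | d
      · simp
      · rw [coeff_X_mul, coeff_derivative, leadingCoeff, hd]
        push_cast
        ring
    have h3 : (derivative f).coeff (f.natDegree + 1) = 0 :=
      coeff_eq_zero_of_natDegree_lt ((natDegree_derivative_le f).trans_lt (by omega))
    simp only [sub_mul, one_mul, coeff_sub, pow_two, mul_assoc, coeff_X_mul, h2, h3, coeff_neg,
      ← C_eq_natCast, coeff_C_mul, zero_sub, neg_inj] at h1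
    exact_mod_cast mul_right_cancel₀ (leadingCoeff_ne_zero.2 hf) h1
  -- Local exponent at `1`: with `f = (x-1)^r g` and `g(1) ≠ 0`, cancelling `(x-1)^r` and evaluating
  -- at `1` gives `2r = m`.
  · obtain ⟨g, hg, hdvd⟩ := exists_eq_pow_rootMultiplicity_mul_and_not_dvd f hf 1
    set r := f.rootMultiplicity 1
    have hu : (X - C (1 : ℂ)) ^ r ≠ 0 := pow_ne_zero _ (X_sub_C_ne_zero 1)
    have hder : (X - C (1 : ℂ)) * derivative f =
        (X - C 1) ^ r * ((r : ℂ[X]) * g + (X - C 1) * derivative g) := by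
      rw [hg, derivative_mul, derivative_X_sub_C_pow]
      rcases r with _ | k
      · simp
      · simp only [Nat.add_sub_cancel, C_eq_natCast]
        ring
    have h1 : (X - C (1 : ℂ)) ^ r * ((X + 1) * ((r : ℂ[X]) * g + (X - C 1) * derivative g)) =
        (X - C (1 : ℂ)) ^ r * ((m : ℂ[X]) * X * g) := by
      calc _ = (X + 1) * ((X - C (1 : ℂ)) * derivative f) := by rw [hder]; ring
        _ = (m : ℂ[X]) * X * f := by
          rw [C_1]
          linear_combination -h
        _ = _ := by rw [hg]; ring
    have h2 := congrArg (eval 1) (mul_left_cancel₀ hu h1)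
    simp only [eval_mul, eval_add, eval_sub, eval_X, eval_one, eval_C, eval_natCast, sub_self,
      zero_mul, add_zero, mul_one, ← mul_assoc] at h2
    have hg1 : g.eval 1 ≠ 0 := fun h0 => hdvd (dvd_iff_isRoot.2 h0)
    have h3 : (1 + 1 : ℂ) * r = m := mul_right_cancel₀ hg1 h2
    exact ⟨r, by rw [← two_mul, ← one_add_one_eq_two]; exact_mod_cast h3.symm⟩

/-! ### Scalar weights: `𝒟(w) = ℂ[δ]`, and equality of eigenvalues -/

namespace ClassicalWeight

open WeylAlgebra

/-- `D` commutes with `δ`, both being diagonal on the eigenpolynomials, so the differential equation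
for the top coefficient shows that the order `m` is even. It remains to see that `Λ` has degree
exactly `m`. -/
theorem even_natDegree_eigenvalue_jacobi {α β : ℝ} {hα : -1 < α} {hβ : -1 < β} {D : WeylAlgebra}
    {Λ : ℂ[X]} (hD : ∀ n : ℕ, act ((jacobi α β hα hβ).opoly n) D =
      Λ.eval (n : ℂ) • (jacobi α β hα hβ).opoly n) : Even Λ.natDegree := by
  set w := jacobi α β hα hβ
  rcases eq_or_ne D 0 with rfl | h0
  · have : Λ = 0 := Polynomial.eq_of_eval_natCast fun n => by
      have := hD n
      rw [act_zero, eq_comm, smul_eq_zero] at this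
      rw [this.resolve_right (w.opoly_ne_zero n), eval_zero]
    simp [this]
  · obtain ⟨m, f, hfm, hf⟩ := exists_top_coeff_ne_zero h0
    have hcomm : D * w.delta = w.delta * D := by
      refine WeylAlgebra.ext_monic_sequence w.opoly_monic w.natDegree_opoly fun n => ?_
      rw [act_mul, act_mul, hD, act_opoly_delta, act_smul_left, act_smul_left, hD,
        act_opoly_delta, smul_comm]
    have hode := w.top_coeff_of_commute hcomm hf
    have hode' : (1 - X ^ 2) * derivative (f m) = -((m : ℂ[X]) * X * f m) := by
      have h2 : (2 : ℂ[X]) ≠ 0 := two_ne_zero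
      refine mul_left_cancel₀ h2 ?_
      simp only [w, lead, derivative_sub, derivative_one, derivative_X_pow] at hode
      simp only [Nat.cast_ofNat, C_ofNat, Nat.add_one_sub_one, pow_one, zero_sub] at hode
      linear_combination hode
    obtain ⟨hdeg, heven⟩ := Polynomial.natDegree_eq_and_even_of_ode hfm hode'
    have hΛ : Λ = ∑ j ∈ Finset.range (m + 1), C ((f j).coeff j) * descPochhammer ℂ j :=
      Polynomial.eq_of_eval_natCast fun n => (w.eigenvalue_of_operator hD hf n).symm
    -- The top coefficient has degree exactly `m`, so the degree `m` term of `Λ` does not vanish.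
    have hc : (f m).coeff m ≠ 0 := by
      have := leadingCoeff_ne_zero.2 hfm
      rwa [leadingCoeff, hdeg] at this
    have hm : (C ((f m).coeff m) * descPochhammer ℂ m).degree = (m : WithBot ℕ) := by
      rw [degree_C_mul hc, degree_eq_natDegree (monic_descPochhammer ℂ m).ne_zero,
        descPochhammer_natDegree]
    have : Λ.degree = (m : WithBot ℕ) := by
      rw [hΛ, Finset.sum_range_succ, degree_add_eq_right_of_degree_lt, hm]
      rw [hm]
      refine (degree_sum_le _ _).trans_lt ((Finset.sup_lt_iff (WithBot.bot_lt_coe m)).2 ?_)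
      intro j hj
      rw [← smul_eq_C_mul]
      refine (degree_smul_le _ _).trans_lt ?_
      rw [degree_eq_natDegree (monic_descPochhammer ℂ j).ne_zero, descPochhammer_natDegree]
      exact Nat.cast_lt.2 (Finset.mem_range.1 hj)
    rwa [natDegree_eq_of_degree_eq_some this]

/-- The Jacobi eigenvalues are, up to sign, the values of the polynomial `x (x + s)`. -/
theorem natDegree_X_mul_X_add_C (s : ℂ) :
    (X * (X + C s)).natDegree = 2 ∧ (X * (X + C s)).Monic :=
  ⟨by rw [natDegree_mul X_ne_zero (X_add_C_ne_zero s), natDegree_X, natDegree_X_add_C],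
    monic_X.mul (monic_X_add_C s)⟩

/-- Descent on the degree: as it is an even number `2e`, the leading term is cancelled by a multiple
of `δ ^ e`. The operator changes along with `Λ`, because evenness at the next stage needs an
operator with the new eigenvalues. -/
theorem exists_eigenvalue_eq_eval_jacobi {α β : ℝ} {hα : -1 < α} {hβ : -1 < β} (k : ℕ)
    (D : WeylAlgebra) (Λ : ℂ[X]) (hk : Λ.degree < k)
    (hD : ∀ n : ℕ, act ((jacobi α β hα hβ).opoly n) D =
      Λ.eval (n : ℂ) • (jacobi α β hα hβ).opoly n) :
    ∃ q : ℂ[X], ∀ n : ℕ, Λ.eval (n : ℂ) = q.eval ((jacobi α β hα hβ).eigenvalue n) := by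
  induction k generalizing D Λ with
  | zero =>
    have h0 : Λ = 0 := by
      ext k
      exact (degree_lt_iff_coeff_zero Λ 0).1 hk k k.zero_le
    exact ⟨0, fun n => by simp [h0]⟩
  | succ k ih =>
    rcases eq_or_ne Λ 0 with rfl | h0
    · exact ⟨0, fun n => by simp⟩
    obtain ⟨e, he⟩ := even_natDegree_eigenvalue_jacobi hD
    set T : ℂ[X] := X * (X + C ((α : ℂ) + β + 1)) with hT
    obtain ⟨hT2, hTm⟩ := natDegree_X_mul_X_add_C ((α : ℂ) + β + 1)
    have hl : Λ.leadingCoeff ≠ 0 := leadingCoeff_ne_zero.2 h0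
    have hTe : (C Λ.leadingCoeff * T ^ e).degree = Λ.degree := by
      rw [degree_C_mul hl, degree_eq_natDegree (hTm.pow e).ne_zero, hTm.natDegree_pow, hT2,
        degree_eq_natDegree h0, he, mul_two]
    set q₀ : ℂ[X] := C Λ.leadingCoeff * (-X) ^ e with hq₀
    have hq : ∀ n : ℕ, q₀.eval ((jacobi α β hα hβ).eigenvalue n) =
        (C Λ.leadingCoeff * T ^ e).eval (n : ℂ) := by
      intro n
      rw [eigenvalue_jacobi]
      simp [hq₀, hT]
    obtain ⟨q, hq'⟩ := ih (D - aeval (jacobi α β hα hβ).delta q₀) (Λ - C Λ.leadingCoeff * T ^ e)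
      (by
        have h1 : (Λ - C Λ.leadingCoeff * T ^ e).degree < Λ.degree := by
          refine degree_sub_lt_left hTe.symm h0 ?_
          rw [leadingCoeff_mul, leadingCoeff_C, (hTm.pow e).leadingCoeff, mul_one]
        refine h1.trans_le ?_
        rw [degree_eq_natDegree h0] at hk ⊢
        exact_mod_cast Nat.lt_succ_iff.1 (by exact_mod_cast hk))
      (fun n => by rw [act_sub, hD, act_opoly_aeval_delta, hq, eval_sub, sub_smul])
    refine ⟨q + q₀, fun n => ?_⟩
    rw [eval_add, ← hq', hq, eval_sub, sub_add_cancel]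

variable {t : ClassicalType} (w : ClassicalWeight t)

/-- The eigenvalues of an operator in `𝒟(w)` are given by a polynomial in those of `δ`. -/
theorem exists_eigenvalue_eq_eval {D : WeylAlgebra} {c : ℕ → ℂ}
    (hD : ∀ n, act (w.opoly n) D = c n • w.opoly n) :
    ∃ q : ℂ[X], ∀ n, c n = q.eval (w.eigenvalue n) := by
  obtain ⟨m, f, hf⟩ := exists_act_eq_sum D
  have hΛ := w.eigenvalue_of_operator hD hf
  set Λ := ∑ j ∈ Finset.range m, C ((f j).coeff j) * descPochhammer ℂ j
  cases w with
  | hermite b =>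
    refine ⟨Λ.comp (C (-1 / 2) * X), fun n => ?_⟩
    rw [← hΛ, eval_comp, eigenvalue_hermite]
    congr 1
    simp only [eval_mul, eval_C, eval_X]
    ring
  | laguerre α hα =>
    refine ⟨Λ.comp (-X), fun n => ?_⟩
    rw [← hΛ, eval_comp, eigenvalue_laguerre]
    congr 1
    simp
  | jacobi α β hα hβ =>
    obtain ⟨q, hq⟩ := exists_eigenvalue_eq_eval_jacobi (Λ.natDegree + 1) D Λ
      (degree_le_natDegree.trans_lt (by exact_mod_cast Nat.lt_succ_self _))
      (fun n => by rw [hΛ, hD])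
    exact ⟨q, fun n => by rw [← hq, hΛ]⟩

/-- Weights related by operators that intertwine their orthogonal polynomials in both directions
have the same eigenvalues. -/
theorem eigenvalue_eq_of_intertwine {w w' : ClassicalWeight t} {V M : WeylAlgebra} {a b : ℕ → ℂ}
    (ha : ∀ n, a n ≠ 0) (hb : ∀ n, b n ≠ 0)
    (hV : ∀ n, act (w.opoly n) V = a n • w'.opoly n)
    (hM : ∀ n, act (w'.opoly n) M = b n • w.opoly n) : w.eigenvalue = w'.eigenvalue := by
  -- Both `V M` and `(δ V - V δ') M` lie in `𝒟(w)`; their eigenvalues `a_n b_n` and `(λ_n - λ'_n)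
  -- a_n b_n` are therefore polynomials in `λ_n`.
  obtain ⟨q, hq⟩ := w.exists_eigenvalue_eq_eval (D := V * M) (c := fun n => a n * b n)
    (fun n => by rw [act_mul, hV, act_smul_left, hM, smul_smul])
  obtain ⟨r, hr⟩ := w.exists_eigenvalue_eq_eval (D := (w.delta * V - V * w'.delta) * M)
    (c := fun n => (w.eigenvalue n - w'.eigenvalue n) * (a n * b n))
    (fun n => by
      rw [act_mul, act_sub, act_mul, act_mul, act_opoly_delta, act_smul_left, hV, act_smul_left,
        act_opoly_delta, act_sub_left, act_smul_left, act_smul_left, act_smul_left, act_smul_left,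
        hM, smul_smul, smul_smul, smul_smul, smul_smul, ← sub_smul]
      congr 1
      ring)
  cases w with
  | hermite b => cases w'; ext n; rw [eigenvalue_hermite, eigenvalue_hermite]
  | laguerre α hα => cases w'; ext n; rw [eigenvalue_laguerre, eigenvalue_laguerre]
  | jacobi α β hα hβ =>
    cases w' with
    | jacobi α' β' hα' hβ' =>
    by_contra hne
    set s : ℂ := α + β + 1 with hs
    set s' : ℂ := α' + β' + 1 with hs'
    have hss : s' - s ≠ 0 := by
      intro h0
      refine hne (funext fun n => ?_)
      rw [eigenvalue_jacobi, eigenvalue_jacobi, ← hs, ← hs', sub_eq_zero.1 h0]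
    have hq0 : q ≠ 0 := by
      rintro rfl
      have := hq 0
      simp [ha, hb] at this
    -- Here `λ_n - λ'_n = (s' - s) n`. The resulting identity has odd degree on the left and even
    -- degree on the right.
    have hid : C (s' - s) * X * q.comp (-(X * (X + C s))) = r.comp (-(X * (X + C s))) := by
      refine Polynomial.eq_of_eval_natCast fun n => ?_
      have h1 := hq n
      have h2 := hr n
      rw [h1, eigenvalue_jacobi, eigenvalue_jacobi, ← hs, ← hs'] at h2
      simp only [eval_mul, eval_C, eval_X, eval_comp, eval_neg, eval_add, ← neg_mul]
      rw [← h2]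
      ring
    have hT : (-(X * (X + C s))).natDegree = 2 := by
      rw [natDegree_neg, (natDegree_X_mul_X_add_C s).1]
    have hqc : q.comp (-(X * (X + C s))) ≠ 0 := by
      intro h0
      rcases comp_eq_zero_iff.1 h0 with h0 | h0
      · exact hq0 h0
      · rw [h0.2, natDegree_C] at hT
        omega
    have hdeg := congrArg natDegree hid
    rw [natDegree_mul (mul_ne_zero (C_ne_zero.2 hss) X_ne_zero) hqc, natDegree_C_mul hss,
      natDegree_X, natDegree_comp, natDegree_comp, hT] at hdeg
    omega

end ClassicalWeight

/-! ### Direct sums of classical weights and the center -/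

namespace ClassicalWeight

open WeylAlgebra WeightMatrix

variable {t : ClassicalType} {ι : Type*} [Fintype ι] [DecidableEq ι]

theorem form_directSum_apply (w : ι → ClassicalWeight t) (P Q : Matrix ι ι ℂ[X]) (i j : ι) :
    (directSum w).form P Q i j =
      ∑ k, (w k).moment (P i k * (Q j k).map (starRingEnd ℂ)) := by
  simp only [form, moment, Matrix.of_apply]
  rw [← integral_finsetSum _ fun k _ => (w k).integrableOn_eval_mul_fn _]
  congr 1
  ext x
  rw [Matrix.mul_apply]
  simp only [directSum, Matrix.mul_diagonal, Matrix.map_apply,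
    Matrix.conjTranspose_apply, eval_mul, eval_map_conj, starRingEnd_apply]
  exact Finset.sum_congr rfl fun k _ => by ring

/-- The monic orthogonal polynomials of a direct sum of classical weights. -/
def opolyMatrix (w : ι → ClassicalWeight t) (n : ℕ) : Matrix ι ι ℂ[X] :=
  Matrix.diagonal fun i => (w i).opoly n

theorem isMonicOrthogonal_opolyMatrix (w : ι → ClassicalWeight t) :
    (directSum w).IsMonicOrthogonal (opolyMatrix w) where
  monic n := by
    ext i j
    rcases eq_or_ne i j with rfl | h
    · simp [opolyMatrix, coeff_opoly]
    · simp [opolyMatrix, h]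
  degree_le n m h := by
    ext i j
    rcases eq_or_ne i j with rfl | hij
    · simp [opolyMatrix, coeff_eq_zero_of_natDegree_lt (((w i).natDegree_opoly n).trans_lt h)]
    · simp [opolyMatrix, hij]
  orthogonal n m h := by
    ext i j
    rw [form_directSum_apply]
    refine Finset.sum_eq_zero fun k _ => ?_
    rcases eq_or_ne i k with rfl | hik
    · rcases eq_or_ne j i with rfl | hji
      · simpa [opolyMatrix] using (w j).moment_opoly_mul_conj_opoly h
      · simp [opolyMatrix, hji, moment_zero]
    · simp [opolyMatrix, hik, moment_zero]

/-- Uniqueness, needed because `diffAlgebra` quantifies over all monic orthogonal sequences.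
Orthogonality to the earlier, diagonal terms makes entry `(i, j)` a multiple of the `n`-th
polynomial of `w j`; monicity makes the factor `1` on the diagonal and `0` off it. -/
theorem eq_opolyMatrix {w : ι → ClassicalWeight t} {P : ℕ → Matrix ι ι ℂ[X]}
    (hP : (directSum w).IsMonicOrthogonal P) (n : ℕ) : P n = opolyMatrix w n := by
  induction n using Nat.strong_induction_on with
  | _ n ih =>
    ext1 i j
    have hdeg : (P n i j).natDegree ≤ n := by
      rw [natDegree_le_iff_coeff_eq_zero]
      intro m hm
      simpa using congrFun (congrFun (hP.degree_le n m hm) i) j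
    have horth : ∀ m < n, (w j).moment (P n i j * ((w j).opoly m).map (starRingEnd ℂ)) = 0 := by
      intro m hm
      have h := congrFun (congrFun (hP.orthogonal n m hm.ne') i) j
      rw [ih m hm, form_directSum_apply, Finset.sum_eq_single j] at h
      · simpa [opolyMatrix] using h
      · intro k _ hk
        simp [opolyMatrix, hk.symm, moment_zero]
      · simp
    rw [(w j).eq_smul_opoly hdeg horth]
    have hcoeff : (P n i j).coeff n = (1 : Matrix ι ι ℂ) i j :=
      congrFun (congrFun (hP.monic n) i) j
    rcases eq_or_ne i j with rfl | hij
    · simp [hcoeff, opolyMatrix]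
    · simp [hcoeff, opolyMatrix, hij]

theorem matAct_opolyMatrix (w : ι → ClassicalWeight t) (n : ℕ) (D : Matrix ι ι WeylAlgebra)
    (i j : ι) : matAct (opolyMatrix w n) D i j = act ((w i).opoly n) (D i j) := by
  simp only [matAct, Matrix.of_apply]
  rw [Finset.sum_eq_single i]
  · simp [opolyMatrix]
  · intro k _ hk
    simp [opolyMatrix, hk.symm, act_zero_left]
  · simp

theorem mul_opolyMatrix (w : ι → ClassicalWeight t) (n : ℕ) (L : Matrix ι ι ℂ) (i j : ι) :
    (L.map C * opolyMatrix w n) i j = L i j • (w j).opoly n := by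
  simp [opolyMatrix, Matrix.mul_diagonal, smul_eq_C_mul]

theorem mem_diffAlgebra_directSum {w : ι → ClassicalWeight t} {D : Matrix ι ι WeylAlgebra} :
    D ∈ (directSum w).diffAlgebra ↔ ∃ c : ℕ → ι → ι → ℂ, ∀ n i j,
      act ((w i).opoly n) (D i j) = c n i j • (w j).opoly n := by
  constructor
  · intro h
    choose L hL using h _ (isMonicOrthogonal_opolyMatrix w)
    refine ⟨L, fun n i j => ?_⟩
    rw [← matAct_opolyMatrix, hL, mul_opolyMatrix]
  · rintro ⟨c, hc⟩ P hP n
    refine ⟨Matrix.of (c n), ?_⟩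
    rw [eq_opolyMatrix hP]
    ext1 i j
    rw [matAct_opolyMatrix, mul_opolyMatrix, hc, Matrix.of_apply]

theorem mem_center {I : Set ℝ} {W : WeightMatrix I ι} {D : Matrix ι ι WeylAlgebra} :
    D ∈ W.center ↔ D ∈ W.diffAlgebra ∧ ∀ E ∈ W.diffAlgebra, E * D = D * E := by
  constructor
  · rintro ⟨⟨D, hD⟩, hc, rfl⟩
    refine ⟨hD, fun E hE => ?_⟩
    exact congrArg Subtype.val (Subalgebra.mem_center_iff.1 hc ⟨E, hE⟩)
  · rintro ⟨hD, hc⟩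
    exact ⟨⟨D, hD⟩, Subalgebra.mem_center_iff.2 fun E => Subtype.ext (hc E E.2), rfl⟩

theorem matDegree_unit (P : Matrix Unit Unit ℂ[X]) : matDegree P = (P () ()).degree := by
  rw [matDegree, show (Finset.univ : Finset (Unit × Unit)) = {((), ())} from rfl,
    Finset.sup_singleton]

/-- Preservation of degree makes the scalars nonzero. The way back comes from `V M ∈ 𝒟(w)`: dividing
its eigenvalue by that of `V` shows how `M` acts. -/
theorem exists_intertwiner {w w' : ClassicalWeight t}
    (h : w.weight.IsDarbouxTransformation w'.weight) :
    ∃ (V M : WeylAlgebra) (a b : ℕ → ℂ), (∀ n, a n ≠ 0) ∧ (∀ n, b n ≠ 0) ∧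
      (∀ n, act (w.opoly n) V = a n • w'.opoly n) ∧
      ∀ n, act (w'.opoly n) M = b n • w.opoly n := by
  obtain ⟨V, M, hV, hM, hVM, hA⟩ := h
  choose A hA using hA _ _ (isMonicOrthogonal_opolyMatrix fun _ : Unit => w)
    (isMonicOrthogonal_opolyMatrix fun _ : Unit => w')
  obtain ⟨c, hc⟩ := mem_diffAlgebra_directSum.1 hVM
  have hact : ∀ n, act (w.opoly n) (V () ()) = A n () () • w'.opoly n := fun n => by
    rw [← matAct_opolyMatrix (fun _ : Unit => w) n V () (), hA, mul_opolyMatrix]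
  have hne : ∀ (U : Matrix Unit Unit WeylAlgebra) (_ : IsDegreePreserving U)
      (u : ClassicalWeight t) (n : ℕ), act (u.opoly n) (U () ()) ≠ 0 := by
    intro U hU u n h0
    have h1 := hU (opolyMatrix (fun _ : Unit => u) n)
    rw [matDegree_unit, matDegree_unit, matAct_opolyMatrix, h0, degree_zero, eq_comm,
      degree_eq_bot] at h1
    exact u.opoly_ne_zero n (by simpa [opolyMatrix] using h1)
  have ha : ∀ n, A n () () ≠ 0 := fun n h0 => hne V hV w n (by rw [hact, h0, zero_smul])
  have hactM : ∀ n, act (w'.opoly n) (M () ()) =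
      ((A n () ())⁻¹ * c n () ()) • w.opoly n := fun n => by
    have h1 := hc n () ()
    rw [Matrix.mul_apply, Fintype.sum_unique, act_mul] at h1
    change act (act (w.opoly n) (V () ())) (M () ()) = c n () () • w.opoly n at h1
    rw [hact, act_smul_left] at h1
    rw [mul_smul, ← h1, inv_smul_smul₀ (ha n)]
  exact ⟨V () (), M () (), fun n => A n () (), _, ha,
    fun n h0 => hne M hM w' n (by rw [hactM, h0, zero_smul]), hact, hactM⟩

theorem aeval_diagonal_delta (w : ι → ClassicalWeight t) (p : ℂ[X]) :
    aeval (Matrix.diagonal fun j => (w j).delta) p =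
      Matrix.diagonal fun j => aeval (w j).delta p := by
  have h := aeval_algHom_apply (Matrix.diagonalAlgHom ℂ : (ι → WeylAlgebra) →ₐ[ℂ] _)
    (fun j => (w j).delta) p
  have h2 : aeval (fun j => (w j).delta) p = fun j => aeval (w j).delta p := by
    ext1 j
    exact (aeval_algHom_apply (Pi.evalAlgHom ℂ (fun _ : ι => WeylAlgebra) j)
      (fun j => (w j).delta) p).symm
  rw [h2] at h
  exact h

theorem diagonal_aeval_mem_diffAlgebra (w : ι → ClassicalWeight t) (p : ι → ℂ[X]) :
    Matrix.diagonal (fun j => aeval (w j).delta (p j)) ∈ (directSum w).diffAlgebra := by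
  refine mem_diffAlgebra_directSum.2
    ⟨fun n i j => if i = j then (p i).eval ((w i).eigenvalue n) else 0, fun n i j => ?_⟩
  beta_reduce
  rcases eq_or_ne i j with rfl | hij
  · rw [Matrix.diagonal_apply_eq, act_opoly_aeval_delta, if_pos rfl]
  · rw [Matrix.diagonal_apply_ne _ hij, act_zero, if_neg hij, zero_smul]

theorem mem_center_directSum {w : ι → ClassicalWeight t} [Nonempty ι]
    (hw : ∀ i j, (w i).weight.IsDarbouxTransformation (w j).weight)
    {D : Matrix ι ι WeylAlgebra} :
    D ∈ (directSum w).center ↔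
      ∃ p : ℂ[X], D = Matrix.diagonal fun j => aeval (w j).delta p := by
  choose V M a b ha hb hV hM using fun i j => exists_intertwiner (hw i j)
  have heig : ∀ i j, (w i).eigenvalue = (w j).eigenvalue := fun i j =>
    eigenvalue_eq_of_intertwine (ha i j) (hb i j) (hV i j) (hM i j)
  rw [mem_center]
  constructor
  · rintro ⟨hD, hcomm⟩
    obtain ⟨c, hc⟩ := mem_diffAlgebra_directSum.1 hD
    have hoff : ∀ i j, i ≠ j → D i j = 0 := by
      intro i j hij
      -- Commuting with the idempotent at position `i` kills the off-diagonal entries of row `i`.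
      have hE : Matrix.diagonal (fun k => if k = i then (1 : WeylAlgebra) else 0) ∈
          (directSum w).diffAlgebra := by
        convert diagonal_aeval_mem_diffAlgebra w (fun k => if k = i then 1 else 0) using 3 with k
        split_ifs <;> simp
      have h := congrFun (congrFun (hcomm _ hE) i) j
      simpa [Matrix.diagonal_mul, Matrix.mul_diagonal, hij.symm] using h
    choose p hp using fun i => (w i).exists_eigenvalue_eq_eval (fun n => hc n i i)
    let i₀ : ι := Classical.arbitrary ι
    refine ⟨p i₀, ?_⟩
    ext1 i j
    rcases eq_or_ne i j with rfl | hij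
    swap
    · rw [hoff i j hij, Matrix.diagonal_apply_ne _ hij]
    rw [Matrix.diagonal_apply_eq]
    -- The intertwiner at position `(i₀, i)` belongs to the algebra; commuting with it says `V D_ii
    -- = D_{i₀i₀} V`, and cancelling the nonzero scalar of `V` equates the eigenvalues of the two
    -- diagonal entries.
    have hE : Matrix.single i₀ i (V i₀ i) ∈ (directSum w).diffAlgebra := by
      refine mem_diffAlgebra_directSum.2
        ⟨fun n k l => if i₀ = k ∧ i = l then a i₀ i n else 0, fun n k l => ?_⟩
      beta_reduce
      rw [Matrix.single_apply]
      split_ifs with h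
      · obtain ⟨rfl, rfl⟩ := h
        exact hV i₀ i n
      · rw [act_zero, zero_smul]
    have h := congrFun (congrFun (hcomm _ hE) i₀) i
    rw [Matrix.single_mul_apply_same, Matrix.mul_single_apply_same] at h
    refine WeylAlgebra.ext_monic_sequence (w i).opoly_monic (w i).natDegree_opoly fun n => ?_
    have h1 := congrArg (act ((w i₀).opoly n)) h
    rw [act_mul, act_mul, hV, act_smul_left, hc, hc, act_smul_left, hV, smul_smul, smul_smul] at h1
    have h2 := smul_left_injective ℂ ((w i).opoly_ne_zero n) h1
    rw [mul_comm] at h2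
    rw [hc, act_opoly_aeval_delta, mul_right_cancel₀ (ha i₀ i n) h2, hp, heig i₀ i]
  · rintro ⟨p, rfl⟩
    refine ⟨diagonal_aeval_mem_diffAlgebra w fun _ => p, fun E hE => ?_⟩
    obtain ⟨c, hc⟩ := mem_diffAlgebra_directSum.1 hE
    ext1 i j
    rw [Matrix.mul_diagonal, Matrix.diagonal_mul]
    -- Whichever factor acts first, the `n`-th polynomial of `w i` is multiplied by `p(λ_n)`, with
    -- the same `λ_n` for `i` and `j`.
    refine WeylAlgebra.ext_monic_sequence (w i).opoly_monic (w i).natDegree_opoly fun n => ?_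
    rw [act_mul, act_mul, hc, act_smul_left, act_opoly_aeval_delta, act_opoly_aeval_delta,
      act_smul_left, hc, heig i j, smul_comm]

/-- A polynomial annihilating `Δ` would vanish at the infinitely many eigenvalues of a single `δ_i`.
-/
theorem transcendental_diagonal_delta (w : ι → ClassicalWeight t) [Nonempty ι] :
    Transcendental ℂ (Matrix.diagonal fun j => (w j).delta) := by
  rw [transcendental_iff]
  intro p hp
  rw [aeval_diagonal_delta] at hp
  let i : ι := Classical.arbitrary ι
  have h0 : aeval (w i).delta p = 0 := by
    simpa using congrFun (congrFun hp i) i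
  refine eq_zero_of_infinite_isRoot p
    ((Set.infinite_range_of_injective (w i).eigenvalue_injective).mono ?_)
  rintro _ ⟨n, rfl⟩
  have h := (w i).act_opoly_aeval_delta n p
  rw [h0, act_zero, eq_comm, smul_eq_zero] at h
  exact h.resolve_right ((w i).opoly_ne_zero n)

end ClassicalWeight

end

theorem theorem5p5 {N : ℕ} (hN : 0 < N) {t : ClassicalType} (w : Fin N → ClassicalWeight t)
    (hw : ∀ i j, (w i).weight.IsDarbouxTransformation (w j).weight)
    (Δ : Matrix (Fin N) (Fin N) WeylAlgebra)
    (hΔ : Δ = Matrix.diagonal fun j => (w j).delta) :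
    (ClassicalWeight.directSum w).center = Algebra.adjoin ℂ {Δ} ∧
    Transcendental ℂ Δ ∧
    ((ClassicalWeight.directSum w).center : Set (Matrix (Fin N) (Fin N) WeylAlgebra)) =
      {D | ∃ p : Polynomial ℂ, D = Polynomial.aeval Δ p} ∧
    ((ClassicalWeight.directSum w).center : Set (Matrix (Fin N) (Fin N) WeylAlgebra)) =
      {D | ∃ p : Polynomial ℂ,
        D = Matrix.diagonal fun j => Polynomial.aeval (w j).delta p} := by
  have : Nonempty (Fin N) := ⟨⟨0, hN⟩⟩
  subst hΔ
  refine ⟨?_, ClassicalWeight.transcendental_diagonal_delta w, ?_, ?_⟩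
  · ext D
    rw [ClassicalWeight.mem_center_directSum hw, Algebra.adjoin_singleton_eq_range_aeval]
    simp only [AlgHom.mem_range, ClassicalWeight.aeval_diagonal_delta, eq_comm]
  · ext D
    simp only [ClassicalWeight.aeval_diagonal_delta]
    exact ClassicalWeight.mem_center_directSum hw
  · ext D
    exact ClassicalWeight.mem_center_directSum hw
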